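/- Let $b\ge 2$ be an integer and $\alpha_1,\alpha_2>0$. Let $\{x\}=x-\lfloor x\rfloor-\frac12$ for $x\in\mathbb R\setminus\mathbb Z$ and $\{x\}=0$ for $x\in\mathbb Z$; for $\alpha>0$ and $y\in\mathbb R$ put $$L_\alpha^b(x)=\sum_{i\ge1}\frac{\{b^ix\}}{b^{\alpha i}},\qquad L_\alpha^{b,y}(x)=\sum_{i\ge1}\frac{\{b^i(x-y)\}}{b^{\alpha i}}\qquad(x\in\mathbb R).$$ For a locally bounded $f:\mathbb R\to\mathbb R$, the Hölder exponent $h_f(x_0)$ is the supremum (possibly $+\infty$) of the $s\ge0$ for which there are $C,r>0$ and a polynomial $P$ with $\deg P<s$ (where $\deg 0=-\infty$) such that $|f(x)-P(x-x_0)|\le C|x-x_0|^s$ for all $x\in[x_0-r,x_0+r]$. For $H_1,H_2\in\mathbb R$ let $$\mathcal D(H_1,H_2)=\dim_H\{x\in\mathbb R:\ h_{L_{\alpha_1}^b}(x)=H_1,\ h_{L_{\alpha_2}^{b,y}}(x)=H_2\},$$ where $\dim_H$ is the Hausdorff dimension and $\dim_H\emptyset=-\infty$. Let $$\Delta^b(y)=\sup\{a\ge1:\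 \|b^ny\|\le b^{-n(a-1)}\ \text{for infinitely many } n\},$$ where $\|\cdot\|$ is the distance to the nearest integer. **Proposition 3.** Let $\eta>1$ and let $(l_i)_{i\ge1}$ be a strictly increasing sequence of nonnegative integers with $l_{i+1}=\lfloor l_i\eta\rfloor$ for all $i\ge1$ (which holds if and only if $l_1(\eta-1)\ge1$, i.e. if $l_1$ is sufficiently large). Let $\nu_i=0^{\lfloor l_i\eta\rfloor-l_i-1}1$ and let $y\in[0,1)$ be the number with $b$-ary expansion $\nu_1\nu_2\nu_3\cdots$. Then $\Delta^b(y)=\eta$, and the bivariate multifractal spectrum of $L_{\alpha_1}^b$ and $L_{\alpha_2}^{b,y}$ is $$\mathcal D(H_1,H_2)=\begin{cases}\dfrac{H_1}{\alpha_1}&\text{if } H_1\in[0,\alpha_1]\text{ and }H_2=\dfrac{\alpha_2}{\alpha_1}H_1,\\[1ex] \min\left\{\dfrac{H_1}{\alpha_1},\dfrac{H_2}{\alpha_2}\right\}&\text{if }(H_1,H_2)\in\left[0,\dfrac{\alpha_1}{\eta}\right]\times\left[0,\dfrac{\alpha_2}{\eta}\right],\\ &\text{or } H_2\in\left[\dfrac{\alpha_2}{\eta},\alpha_2\right]\text{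 and } H_1\in\left[\dfrac{\alpha_1H_2^2}{\alpha_2^2},\dfrac{\alpha_1H_2}{\alpha_2}\right],\\ &\text{or } H_1\in\left[\dfrac{\alpha_1}{\eta},\alpha_1\right]\text{ and } H_2\in\left[\dfrac{\alpha_2H_1^2}{\alpha_1^2},\dfrac{\alpha_2H_1}{\alpha_1}\right],\\[1ex] -\infty&\text{otherwise.}\end{cases}$$ -/

import Mathlib

noncomputable section

namespace LevySpectrum

/-- The `1`-periodic saw-tooth function: `x - ⌊x⌋ - 1/2` off the integers, `0` on them. -/
def sawtooth (x : ℝ) : ℝ :=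
  open Classical in if x ∈ Set.range ((↑) : ℤ → ℝ) then 0 else x - ⌊x⌋ - 1 / 2

/-- The Lévy function `L_α^b(x) = ∑_{i ≥ 1} {b^i x} / b^{α i}`
(the series converges absolutely for `b ≥ 2`, `α > 0`). -/
def levy (b : ℕ) (α : ℝ) (x : ℝ) : ℝ :=
  ∑' i : ℕ, sawtooth ((b : ℝ) ^ (i + 1) * x) / (b : ℝ) ^ (α * ((i + 1 : ℕ) : ℝ))

/-- The translated Lévy function `L_α^{b,y}(x) = ∑_{i ≥ 1} {b^i (x - y)} / b^{α i}`. -/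
def levyTranslate (b : ℕ) (α y : ℝ) (x : ℝ) : ℝ :=
  ∑' i : ℕ, sawtooth ((b : ℝ) ^ (i + 1) * (x - y)) / (b : ℝ) ^ (α * ((i + 1 : ℕ) : ℝ))

/-- `f` belongs to the pointwise Hölder space `C^s(x₀)`: near `x₀`, `f` agrees up to
`C |x - x₀|^s` with a polynomial in `x - x₀` of degree less than `s`.
(The zero polynomial has degree `-∞`, so for `s = 0` this is boundedness near `x₀`.) -/
def PointwiseHolder (s : ℝ) (f : ℝ → ℝ) (x₀ : ℝ) : Prop :=
  ∃ C > (0 : ℝ), ∃ r > (0 : ℝ), ∃ P : Polynomial ℝ, (P = 0 ∨ (P.natDegree : ℝ) < s) ∧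
    ∀ x ∈ Set.Icc (x₀ - r) (x₀ + r), |f x - P.eval (x - x₀)| ≤ C * |x - x₀| ^ s

/-- The Hölder exponent of `f` at `x₀`, possibly `+∞`. -/
def holderExponent (f : ℝ → ℝ) (x₀ : ℝ) : EReal :=
  sSup {h : EReal | ∃ s : ℝ, 0 ≤ s ∧ PointwiseHolder s f x₀ ∧ h = (s : EReal)}

/-- The bivariate level set of points where `f` has Hölder exponent `H₁` and `g` has `H₂`. -/
def levelSet (f g : ℝ → ℝ) (H₁ H₂ : ℝ) : Set ℝ :=
  {x | holderExponent f x = (H₁ : EReal) ∧ holderExponent g x = (H₂ : EReal)}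

/-- The Hausdorff dimension, with the convention `dim ∅ = -∞`. -/
def hausdorffDim (E : Set ℝ) : EReal :=
  open Classical in if E = ∅ then ⊥ else (dimH E : EReal)

/-- The bivariate multifractal spectrum of `(f, g)`. -/
def spectrum (f g : ℝ → ℝ) (H₁ H₂ : ℝ) : EReal :=
  hausdorffDim (levelSet f g H₁ H₂)

/-- The distance from `x` to the nearest integer. -/
def distInt (x : ℝ) : ℝ := |x - round x|

/-- The `b`-adic approximation exponent: the supremum, possibly `+∞`, of the `a ≥ 1` such that
`‖b^n x‖ ≤ 1 / b^{n (a - 1)}` for infinitely many `n`. -/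
def approxExponent (b : ℕ) (x : ℝ) : EReal :=
  sSup {e : EReal | ∃ a : ℝ, 1 ≤ a ∧
    {n : ℕ | distInt ((b : ℝ) ^ n * x) ≤ 1 / (b : ℝ) ^ ((n : ℝ) * (a - 1))}.Infinite ∧
    e = (a : EReal)}

/-- The infinite word `w` starts with each of the finite concatenations `ν 0 ν 1 ⋯ ν (k-1)`;
when all the words `ν k` are nonempty this says that `w` is the concatenation `ν 0 ν 1 ν 2 ⋯`. -/
def IsConcatenation {A : Type*} (ν : ℕ → List A) (w : ℕ → A) : Prop :=
  ∀ k n : ℕ, n < ((List.range k).flatMap ν).length →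
    ((List.range k).flatMap ν)[n]? = some (w n)

/-- The block `0^{⌊l η⌋ - l - 1} 1`. -/
def block (η : ℝ) (l : ℕ) : List ℕ :=
  List.replicate (⌊(l : ℝ) * η⌋₊ - l - 1) 0 ++ [1]

end LevySpectrum

end

section

open Filter Topology Set

noncomputable section

namespace LevySpectrum

/-! ### Distance to the nearest integer -/

/-! Both Hölder exponents are governed by `b`-adic approximation. Write `w(x)` for `invExponent b
x`, the inverse of the approximation exponent of `x`. The series has a jump of size at least
`b^(-αn)` at each `k / b^n`, which caps the regularity at points close to such fractions. Away from
them every term is affine. Hence the exponents at `x` are `α₁ w(x)` and `α₂ w(x - y)`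
(`holderExponent_levy`, `holderExponent_levyTranslate`). With `u = H₁/α₁` and `v = H₂/α₂`, the level
set is `{w(x) = u, w(x - y) = v}`, and `α₁`, `α₂` play no further role.

Upper bound: covering by intervals around `b`-adic fractions gives `dim {w ≤ u} ≤ u`. Applied to `x`
and to `x - y`, this gives `min u v`.

Empty part: the expansion of `y` is zero except for isolated ones at positions growing like `η^i`.
If `x` is close to a `b`-adic fraction from position `n` up to about `n/u`, then either the next one
of `y` is so far away that `x - y` is well approximated at `n`, or `x - y` is well approximated just
after that one. This forces `v ≤ max √u η⁻¹` (`IsLacunary.invExponent_sub_le`), and by the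
reflection `x ↦ y - x` also `u ≤ max √v η⁻¹`. These two inequalities, with `u, v ∈ [0, 1]`, describe
exactly the region of the theorem.

Lower bound, for `u ≤ v` by the same reflection: build `x` from blocks of `K` digits. On sparse runs
`[S, T)` of blocks, `x` alternately vanishes (`T/S → 1/u`, which produces `w(x) = u`) or copies `y`
(`T/S → 1/v`, which produces `w(x - y) = v`). Every other block holds `K - 2` free digits followed
by `0, 1`, which prevents any unplanned approximation. The zero runs must not make `x - y` too well
approximable. They therefore start near `max 1 (ηv)` times the position of a one of `y`, and this is
where `v ≤ η⁻¹` or `v² ≤ u` is used (`IsRunExpansion.even_run_bound`). The density of free digits is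
lowest at the end of a zero run, about `u`. Reading off the free digits is then a Hölder map onto
`[0, 1]` with exponent close to `u`, so the dimension is at least `u`. -/

theorem distInt_nonneg (x : ℝ) : 0 ≤ distInt x := abs_nonneg _

theorem distInt_le (x : ℝ) (k : ℤ) : distInt x ≤ |x - k| := round_le x k

theorem distInt_le_one (x : ℝ) : distInt x ≤ 1 := by
  have := abs_sub_round x
  unfold distInt
  linarith

theorem distInt_le_abs (x : ℝ) : distInt x ≤ |x| := by simpa using distInt_le x 0

theorem distInt_neg_le (x : ℝ) : distInt (-x) ≤ distInt x := by
  have := distInt_le (-x) (-round x)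
  have h : |-x - ((-round x : ℤ) : ℝ)| = |x - round x| := by
    rw [← abs_neg]; congr 1; push_cast; ring
  rwa [h] at this

theorem distInt_neg (x : ℝ) : distInt (-x) = distInt x :=
  le_antisymm (distInt_neg_le x) (by simpa using distInt_neg_le (-x))

theorem distInt_add_le (x z : ℝ) : distInt (x + z) ≤ distInt x + distInt z := by
  refine (distInt_le (x + z) (round x + round z)).trans ?_
  have h : x + z - ((round x + round z : ℤ) : ℝ) = (x - round x) + (z - round z) := by
    push_cast; ring
  rw [h]
  exact abs_add_le _ _

theorem distInt_sub_le (x z : ℝ) : distInt (x - z) ≤ distInt x + distInt z := by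
  simpa [sub_eq_add_neg, distInt_neg] using distInt_add_le x (-z)

theorem distInt_le_add_sub (x z : ℝ) : distInt x ≤ distInt z + distInt (x - z) := by
  simpa using distInt_add_le z (x - z)

theorem distInt_natCast_mul_le (k : ℕ) (x : ℝ) : distInt (k * x) ≤ k * distInt x := by
  refine (distInt_le (k * x) (k * round x)).trans (le_of_eq ?_)
  have h : (k : ℝ) * x - ((k * round x : ℤ) : ℝ) = k * (x - round x) := by push_cast; ring
  rw [h, abs_mul, Nat.abs_cast, distInt]

theorem distInt_pow_mul_le (b : ℕ) {m n : ℕ} (h : n ≤ m) (x : ℝ) :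
    distInt ((b : ℝ) ^ m * x) ≤ (b : ℝ) ^ (m - n) * distInt ((b : ℝ) ^ n * x) := by
  have := distInt_natCast_mul_le (b ^ (m - n)) ((b : ℝ) ^ n * x)
  push_cast at this
  rwa [← mul_assoc, ← pow_add, Nat.sub_add_cancel h] at this

theorem le_distInt_of_le_of_le {x c : ℝ} (h0 : c ≤ x) (h1 : x ≤ 1 - c) : c ≤ distInt x := by
  unfold distInt
  rcases le_or_gt (round x) 0 with h | h
  · have : (round x : ℝ) ≤ 0 := by exact_mod_cast h
    rw [le_abs]; left; linarith
  · have : (1 : ℝ) ≤ round x := by exact_mod_cast h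
    rw [le_abs]; right; linarith

/-! ### The inverse approximation exponent -/

/-- The set of rates `a` at which `x` is approximable by `b`-adic numbers. -/
def approxSet (b : ℕ) (x : ℝ) : Set ℝ :=
  {a | 1 ≤ a ∧ {n : ℕ | distInt ((b : ℝ) ^ n * x) ≤ 1 / (b : ℝ) ^ ((n : ℝ) * (a - 1))}.Infinite}

/-- The inverse of the `b`-adic approximation exponent. -/
def invExponent (b : ℕ) (x : ℝ) : ℝ := sInf ((fun a => a⁻¹) '' approxSet b x)

theorem one_mem_approxSet (b : ℕ) (x : ℝ) : (1 : ℝ) ∈ approxSet b x := by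
  refine ⟨le_rfl, ?_⟩
  convert! Set.infinite_univ (α := ℕ)
  ext n
  simp [distInt_le_one]

theorem approxSet_bddBelow (b : ℕ) (x : ℝ) : BddBelow ((fun a => a⁻¹) '' approxSet b x) :=
  ⟨0, by rintro _ ⟨a, ha, rfl⟩; exact inv_nonneg.2 (zero_le_one.trans ha.1)⟩

theorem invExponent_le_inv {b : ℕ} {x a : ℝ} (ha : a ∈ approxSet b x) : invExponent b x ≤ a⁻¹ :=
  csInf_le (approxSet_bddBelow b x) ⟨a, ha, rfl⟩

theorem invExponent_nonneg (b : ℕ) (x : ℝ) : 0 ≤ invExponent b x :=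
  le_csInf ⟨_, 1, one_mem_approxSet b x, rfl⟩
    (by rintro _ ⟨a, ha, rfl⟩; exact inv_nonneg.2 (zero_le_one.trans ha.1))

theorem invExponent_le_one (b : ℕ) (x : ℝ) : invExponent b x ≤ 1 := by
  simpa using invExponent_le_inv (one_mem_approxSet b x)

theorem exists_mem_approxSet_of_invExponent_lt {b : ℕ} {x t : ℝ} (h : invExponent b x < t) :
    ∃ a ∈ approxSet b x, a⁻¹ < t := by
  obtain ⟨_, ⟨a, ha, rfl⟩, h⟩ := exists_lt_of_csInf_lt
    (Set.Nonempty.image _ ⟨1, one_mem_approxSet b x⟩) h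
  exact ⟨a, ha, h⟩

/-- The conditions are stated with products `a * u` rather than with `u⁻¹` so that `u = 0`, an
infinite approximation exponent, is covered. -/
theorem invExponent_eq_of {b : ℕ} {x u : ℝ} (h0 : 0 ≤ u)
    (hU : ∀ a ∈ approxSet b x, a * u ≤ 1) (hL : ∀ a, 1 ≤ a → a * u < 1 → a ∈ approxSet b x) :
    invExponent b x = u := by
  apply le_antisymm
  · by_contra! h
    obtain ⟨c, hc, hc'⟩ := exists_between h
    have hc0 : 0 < c := h0.trans_lt hc
    have hmem : c⁻¹ ∈ approxSet b x := by
      refine hL _ ?_ ?_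
      · exact (one_le_inv₀ hc0).2 (hc'.le.trans (invExponent_le_one b x))
      · rw [inv_mul_eq_div]; exact (div_lt_one hc0).2 hc
    have := invExponent_le_inv hmem
    rw [inv_inv] at this
    linarith
  · refine le_csInf ⟨_, 1, one_mem_approxSet b x, rfl⟩ ?_
    rintro _ ⟨a, ha, rfl⟩
    have ha0 : 0 < a := zero_lt_one.trans_le ha.1
    have := hU a ha
    change u ≤ a⁻¹
    rw [← one_div, le_div_iff₀ ha0, mul_comm]
    exact this

theorem approxExponent_eq_of {b : ℕ} {x u : ℝ} (h0 : 0 < u) (h1 : u ≤ 1)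
    (hU : ∀ a ∈ approxSet b x, a * u ≤ 1) (hL : ∀ a, 1 ≤ a → a * u < 1 → a ∈ approxSet b x) :
    approxExponent b x = ((u⁻¹ : ℝ) : EReal) := by
  unfold approxExponent
  apply le_antisymm
  · refine sSup_le ?_
    rintro _ ⟨a, ha, ha', rfl⟩
    have := hU a ⟨ha, ha'⟩
    rw [EReal.coe_le_coe_iff, ← one_div, le_div_iff₀ h0]
    exact this
  · refine le_of_forall_lt fun c hc => ?_
    obtain ⟨d, hd, hd'⟩ := EReal.lt_iff_exists_real_btwn.1 hc
    have hd1 : d < u⁻¹ := by exact_mod_cast hd'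
    -- For `u = 1` the hypothesis `hL` gives nothing, since no `a ≥ 1` satisfies `a * u < 1`. But
    -- then `max d 1 = 1`, which is always an admissible rate.
    have hmem : max d 1 ∈ approxSet b x ∨ u = 1 := by
      rcases h1.lt_or_eq with h | h
      · left
        refine hL _ (le_max_right _ _) ?_
        rw [← lt_div_iff₀ h0, one_div]
        exact max_lt hd1 ((one_lt_inv₀ h0).2 h)
      · exact Or.inr h
    have hmem : max d 1 ∈ approxSet b x := by
      rcases hmem with h | h
      · exact h
      · subst h
        rw [max_eq_right (by simpa using hd1.le)]
        exact one_mem_approxSet b x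
    refine hd.trans_le ?_
    refine le_trans (b := ((max d 1 : ℝ) : EReal)) (by exact_mod_cast le_max_left _ _) ?_
    exact le_sSup ⟨max d 1, hmem.1, hmem.2, rfl⟩

theorem tendsto_mul_rpow_neg {b : ℕ} (hb : 2 ≤ b) (C : ℝ) {c : ℝ} (hc : 0 < c) :
    Tendsto (fun n : ℕ => C * (b : ℝ) ^ (-((n : ℝ) * c))) atTop (𝓝 0) := by
  have hb1 : (1 : ℝ) < b := by exact_mod_cast hb
  have h0 : Tendsto (fun n : ℕ => (n : ℝ) * c) atTop atTop :=
    tendsto_natCast_atTop_atTop.atTop_mul_const hc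
  have h1 := (tendsto_rpow_atTop_of_base_gt_one _ hb1).comp h0
  have h2 := h1.inv_tendsto_atTop.const_mul C
  rw [mul_zero] at h2
  refine h2.congr fun n => ?_
  simp [Real.rpow_neg (zero_le_one.trans hb1.le)]

/-- Multiplication by `b^(m - n)` enlarges the distance to the integers by at most that factor. A
position `m ≤ (n + C)/u` where the distance is at least `c` thus bounds the distance at `n` below by
`c b^(n - m)`, which excludes rates beyond `1/u`. -/
theorem mul_le_one_of_mem_approxSet {b : ℕ} (hb : 2 ≤ b) {x u C c : ℝ} {n₀ : ℕ} (hc : 0 < c)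
    (h : ∀ n, n₀ ≤ n → ∃ m, n ≤ m ∧ u * m ≤ n + C ∧ c ≤ distInt ((b : ℝ) ^ m * x))
    {a : ℝ} (ha : a ∈ approxSet b x) : a * u ≤ 1 := by
  by_contra! hau
  have ha0 : 0 < a := zero_lt_one.trans_le ha.1
  have hu : 0 < u := by
    by_contra! hu
    have := mul_nonpos_of_nonneg_of_nonpos ha0.le hu
    linarith
  have hb1 : (1 : ℝ) < b := by exact_mod_cast hb
  have hb0 : (0 : ℝ) < b := by linarith
  have hd : 0 < a - u⁻¹ := by
    rw [sub_pos, ← one_div, div_lt_iff₀ hu]; exact hau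
  have hev := (tendsto_mul_rpow_neg hb ((b : ℝ) ^ (C / u)) hd).eventually_lt_const hc
  obtain ⟨N, hN⟩ := eventually_atTop.1 hev
  obtain ⟨n, hn, hnN⟩ := ha.2.exists_gt (max N n₀)
  have hn : distInt ((b : ℝ) ^ n * x) ≤ 1 / (b : ℝ) ^ ((n : ℝ) * (a - 1)) := hn
  obtain ⟨m, hnm, hm, hcm⟩ := h n (by omega)
  have h1 := hN n (by omega)
  have hm' : (m : ℝ) ≤ n * u⁻¹ + C / u := by
    rw [← div_eq_mul_inv, ← add_div, le_div_iff₀ hu]; linarith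
  have h2 := distInt_pow_mul_le b hnm x
  have h3 : (b : ℝ) ^ (m - n) * distInt ((b : ℝ) ^ n * x)
      ≤ (b : ℝ) ^ ((m : ℝ) - n) * (b : ℝ) ^ (-((n : ℝ) * (a - 1))) := by
    rw [Real.rpow_neg hb0.le, ← one_div]
    refine mul_le_mul (le_of_eq ?_) hn (distInt_nonneg _) (by positivity)
    rw [← Nat.cast_sub hnm, Real.rpow_natCast]
  rw [← Real.rpow_add hb0] at h3
  rw [← Real.rpow_add hb0] at h1
  have h4 : (b : ℝ) ^ ((m : ℝ) - n + -((n : ℝ) * (a - 1)))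
      ≤ (b : ℝ) ^ (C / u + -((n : ℝ) * (a - u⁻¹))) := by
    apply Real.rpow_le_rpow_of_exponent_le hb1.le
    nlinarith
  linarith

/-- The constant `C` is absorbed by passing from the rate `a'` to a smaller one. -/
theorem mem_approxSet_of_frequently {b : ℕ} (hb : 2 ≤ b) {x a a' C : ℝ} (ha : 1 ≤ a) (haa : a < a')
    (h : ∀ N : ℕ, ∃ n, N ≤ n ∧ distInt ((b : ℝ) ^ n * x) ≤ C * (b : ℝ) ^ (-((n : ℝ) * (a' - 1)))) :
    a ∈ approxSet b x := by
  refine ⟨ha, ?_⟩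
  have hb1 : (1 : ℝ) < b := by exact_mod_cast hb
  have hb0 : (0 : ℝ) < b := by linarith
  have hev := (tendsto_mul_rpow_neg hb C (sub_pos.2 haa)).eventually_lt_const one_pos
  obtain ⟨N, hN⟩ := eventually_atTop.1 hev
  rw [Set.infinite_iff_exists_gt]
  intro M
  obtain ⟨n, hn, hdn⟩ := h (max N (M + 1))
  refine ⟨n, ?_, by omega⟩
  have h1 := hN n (by omega)
  change distInt ((b : ℝ) ^ n * x) ≤ 1 / (b : ℝ) ^ ((n : ℝ) * (a - 1))
  rw [one_div, ← Real.rpow_neg hb0.le]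
  refine hdn.trans ?_
  have h2 : -((n : ℝ) * (a' - 1)) = -((n : ℝ) * (a' - a)) + -((n : ℝ) * (a - 1)) := by ring
  rw [h2, Real.rpow_add hb0, ← mul_assoc]
  exact mul_le_of_le_one_left (by positivity) h1.le

theorem approxSet_neg (b : ℕ) (x : ℝ) : approxSet b (-x) = approxSet b x := by
  simp [approxSet, distInt_neg]

theorem invExponent_neg (b : ℕ) (x : ℝ) : invExponent b (-x) = invExponent b x := by
  simp [invExponent, approxSet_neg]

/-! ### The saw-tooth function -/

theorem sawtooth_of_floor {x : ℝ} {k : ℤ} (h0 : (k : ℝ) < x) (h1 : x < k + 1) :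
    sawtooth x = x - k - 1 / 2 := by
  have hx : x ∉ Set.range ((↑) : ℤ → ℝ) := by
    rintro ⟨m, rfl⟩
    have a1 : k < m := by exact_mod_cast h0
    have a2 : m < k + 1 := by exact_mod_cast h1
    omega
  have hf : ⌊x⌋ = k := Int.floor_eq_iff.2 ⟨h0.le, h1⟩
  rw [sawtooth, if_neg hx, hf]

theorem abs_sawtooth_le (x : ℝ) : |sawtooth x| ≤ 1 / 2 := by
  unfold sawtooth
  split_ifs with h
  · norm_num
  · rw [abs_le]
    have := Int.floor_le x
    have := Int.lt_floor_add_one x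
    constructor <;> linarith

/-- No integer separates `t` from `t₀`, and between consecutive integers the function has slope 1.
-/
theorem sawtooth_sub_of_lt_distInt {t t₀ : ℝ} (h : |t - t₀| < distInt t₀) :
    sawtooth t - sawtooth t₀ = t - t₀ := by
  have h1 := distInt_le t₀ ⌊t₀⌋
  have h2 := distInt_le t₀ (⌊t₀⌋ + 1)
  have h3 := Int.floor_le t₀
  have h4 := Int.lt_floor_add_one t₀
  rw [abs_of_nonneg (by linarith)] at h1
  rw [abs_of_nonpos (by push_cast; linarith)] at h2
  push_cast at h2
  have h0 := abs_nonneg (t - t₀)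
  rw [abs_lt] at h
  rw [sawtooth_of_floor (k := ⌊t₀⌋) (by linarith) (by linarith),
    sawtooth_of_floor (x := t₀) (k := ⌊t₀⌋) (by linarith) (by linarith)]
  ring

open Classical in
theorem tendsto_sawtooth_sub (t : ℝ) :
    Tendsto (fun δ => sawtooth (t - δ) - sawtooth (t + δ)) (𝓝[>] 0)
      (𝓝 (if distInt t = 0 then 1 else 0)) := by
  split_ifs with h
  · have ht : t = round t := by
      rw [distInt, abs_eq_zero, sub_eq_zero] at h; exact h
    have h1 : Tendsto (fun δ : ℝ => 1 - 2 * δ) (𝓝[>] 0) (𝓝 1) := by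
      have : Tendsto (fun δ : ℝ => 1 - 2 * δ) (𝓝 0) (𝓝 (1 - 2 * 0)) := by
        apply Continuous.tendsto; fun_prop
      simpa using this.mono_left nhdsWithin_le_nhds
    refine h1.congr' ?_
    have : Ioo (0 : ℝ) 1 ∈ 𝓝[>] (0 : ℝ) := Ioo_mem_nhdsGT one_pos
    filter_upwards [this] with δ hδ
    rw [ht, sawtooth_of_floor (x := (round t : ℝ) - δ) (k := round t - 1),
      sawtooth_of_floor (x := (round t : ℝ) + δ) (k := round t)]
    · push_cast; ring
    · linarith [hδ.1]
    · linarith [hδ.2]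
    · push_cast; linarith [hδ.2]
    · push_cast; linarith [hδ.1]
  · have hpos : 0 < distInt t := lt_of_le_of_ne (distInt_nonneg t) (Ne.symm h)
    have h1 : Tendsto (fun δ : ℝ => -(2 * δ)) (𝓝[>] 0) (𝓝 0) := by
      have : Tendsto (fun δ : ℝ => -(2 * δ)) (𝓝 0) (𝓝 (-(2 * 0))) := by
        apply Continuous.tendsto; fun_prop
      simpa using this.mono_left nhdsWithin_le_nhds
    refine h1.congr' ?_
    have : Ioo (0 : ℝ) (distInt t) ∈ 𝓝[>] (0 : ℝ) := Ioo_mem_nhdsGT hpos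
    filter_upwards [this] with δ hδ
    have e1 := sawtooth_sub_of_lt_distInt (t := t - δ) (t₀ := t)
      (by rw [sub_sub_cancel_left, abs_neg, abs_of_pos hδ.1]; exact hδ.2)
    have e2 := sawtooth_sub_of_lt_distInt (t := t + δ) (t₀ := t)
      (by rw [add_sub_cancel_left, abs_of_pos hδ.1]; exact hδ.2)
    linarith

/-! ### The Lévy function -/

theorem summable_inv_rpow {b : ℕ} (hb : 2 ≤ b) {γ : ℝ} (hγ : 0 < γ) :
    Summable fun i : ℕ => 1 / (b : ℝ) ^ (γ * ((i + 1 : ℕ) : ℝ)) := by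
  have hb1 : (1 : ℝ) < b := by exact_mod_cast hb
  have hb0 : (0 : ℝ) < b := by linarith
  have hs : Summable fun i : ℕ => ((b : ℝ) ^ (-γ)) ^ i :=
    summable_geometric_of_lt_one (by positivity)
      (Real.rpow_lt_one_of_one_lt_of_neg hb1 (by linarith))
  refine ((summable_nat_add_iff 1).2 hs).congr fun i => ?_
  rw [one_div, ← Real.rpow_neg hb0.le, ← Real.rpow_mul_natCast hb0.le]
  congr 1; ring

theorem norm_sawtooth_div_le (b : ℕ) (γ t : ℝ) :
    ‖sawtooth t / (b : ℝ) ^ γ‖ ≤ 1 / (b : ℝ) ^ γ := by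
  have h : (0 : ℝ) ≤ (b : ℝ) ^ γ := by positivity
  rw [Real.norm_eq_abs, abs_div, abs_of_nonneg h]
  have := abs_sawtooth_le t
  gcongr
  linarith

theorem summable_levy {b : ℕ} (hb : 2 ≤ b) {α : ℝ} (hα : 0 < α) (x : ℝ) :
    Summable fun i : ℕ =>
      sawtooth ((b : ℝ) ^ (i + 1) * x) / (b : ℝ) ^ (α * ((i + 1 : ℕ) : ℝ)) :=
  Summable.of_norm_bounded (summable_inv_rpow hb hα) fun _ => norm_sawtooth_div_le b _ _

theorem abs_levy_le {b : ℕ} (hb : 2 ≤ b) {α : ℝ} (hα : 0 < α) (x : ℝ) :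
    |levy b α x| ≤ ∑' i : ℕ, 1 / (b : ℝ) ^ (α * ((i + 1 : ℕ) : ℝ)) :=
  tsum_of_norm_bounded (summable_inv_rpow hb hα).hasSum fun _ => norm_sawtooth_div_le b _ _

open Classical in
/-- The size of the (downward) jump of the Lévy function at a point. -/
def levyJump (b : ℕ) (α z : ℝ) : ℝ :=
  ∑' i : ℕ, (if distInt ((b : ℝ) ^ (i + 1) * z) = 0 then 1 else 0) /
    (b : ℝ) ^ (α * ((i + 1 : ℕ) : ℝ))

theorem tendsto_levy_sub {b : ℕ} (hb : 2 ≤ b) {α : ℝ} (hα : 0 < α) (z : ℝ) :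
    Tendsto (fun δ => levy b α (z - δ) - levy b α (z + δ)) (𝓝[>] 0) (𝓝 (levyJump b α z)) := by
  have hb0 : (0 : ℝ) < b := by positivity
  have hfun : (fun δ => levy b α (z - δ) - levy b α (z + δ)) = fun δ => ∑' i : ℕ,
      (sawtooth ((b : ℝ) ^ (i + 1) * (z - δ)) - sawtooth ((b : ℝ) ^ (i + 1) * (z + δ))) /
        (b : ℝ) ^ (α * ((i + 1 : ℕ) : ℝ)) := by
    funext δ
    rw [levy, levy, ← (summable_levy hb hα _).tsum_sub (summable_levy hb hα _)]
    simp only [sub_div]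
  rw [hfun]
  refine tendsto_tsum_of_dominated_convergence (summable_inv_rpow hb hα) (fun i => ?_)
    (Eventually.of_forall fun δ i => ?_)
  · refine Tendsto.div_const ?_ _
    have hlim : Tendsto (fun δ : ℝ => (b : ℝ) ^ (i + 1) * δ) (𝓝[>] 0) (𝓝[>] 0) := by
      refine tendsto_nhdsWithin_iff.2 ⟨?_, ?_⟩
      · have : Tendsto (fun δ : ℝ => (b : ℝ) ^ (i + 1) * δ) (𝓝 0) (𝓝 ((b : ℝ) ^ (i + 1) * 0)) := by
          apply Continuous.tendsto; fun_prop
        simpa using this.mono_left nhdsWithin_le_nhds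
      · filter_upwards [self_mem_nhdsWithin] with δ hδ
        have hδ : 0 < δ := hδ
        exact mul_pos (by positivity) hδ
    refine ((tendsto_sawtooth_sub ((b : ℝ) ^ (i + 1) * z)).comp hlim).congr fun δ => ?_
    simp only [Function.comp]
    ring_nf
  · have h : (0 : ℝ) ≤ (b : ℝ) ^ (α * ((i + 1 : ℕ) : ℝ)) := by positivity
    rw [Real.norm_eq_abs, abs_div, abs_of_nonneg h]
    have h1 := abs_sawtooth_le ((b : ℝ) ^ (i + 1) * (z - δ))
    have h2 := abs_sawtooth_le ((b : ℝ) ^ (i + 1) * (z + δ))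
    have h3 := abs_sub (sawtooth ((b : ℝ) ^ (i + 1) * (z - δ)))
      (sawtooth ((b : ℝ) ^ (i + 1) * (z + δ)))
    gcongr
    linarith

/-- All terms jump in the same direction, so jumps cannot cancel and the term of index `n` alone
gives the bound. -/
theorem le_levyJump {b : ℕ} (hb : 2 ≤ b) {α : ℝ} (hα : 0 < α) {n : ℕ} (hn : 1 ≤ n) (k : ℤ) :
    1 / (b : ℝ) ^ (α * (n : ℝ)) ≤ levyJump b α (k / (b : ℝ) ^ n) := by
  classical
  have hb0 : (b : ℝ) ≠ 0 := by positivity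
  obtain ⟨i, rfl⟩ : ∃ i, n = i + 1 := ⟨n - 1, by omega⟩
  have hs : Summable fun j : ℕ => (if distInt ((b : ℝ) ^ (j + 1) * (k / (b : ℝ) ^ (i + 1))) = 0
      then (1 : ℝ) else 0) / (b : ℝ) ^ (α * ((j + 1 : ℕ) : ℝ)) := by
    refine Summable.of_nonneg_of_le (fun j => ?_) (fun j => ?_) (summable_inv_rpow hb hα)
    · split_ifs <;> positivity
    · gcongr
      split_ifs <;> norm_num
  have h := hs.le_tsum i (fun j _ => by split_ifs <;> positivity)
  refine le_trans (le_of_eq ?_) h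
  rw [if_pos]
  rw [mul_div_cancel₀ _ (by positivity)]
  simp [distInt]

/-- Compare the values at `z - δ` and `z + δ` as `δ → 0`. The polynomial is continuous and drops
out, so its degree plays no role. -/
theorem levyJump_le_of_pointwiseHolder {b : ℕ} (hb : 2 ≤ b) {α : ℝ} (hα : 0 < α) {s x : ℝ}
    (hs : 0 < s) (h : PointwiseHolder s (levy b α) x) :
    ∃ C : ℝ, ∃ r > (0 : ℝ), ∀ z, |z - x| < r → levyJump b α z ≤ C * |z - x| ^ s := by
  obtain ⟨C, hC, r, hr, P, -, hP⟩ := h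
  refine ⟨2 * C, r, hr, fun z hz => ?_⟩
  have hPc : Continuous fun δ : ℝ => P.eval (z - δ - x) - P.eval (z + δ - x) := by fun_prop
  have hP0 := (hPc.tendsto 0).mono_left (nhdsWithin_le_nhds (s := Ioi 0))
  have hRc : Continuous fun δ : ℝ => C * |z - δ - x| ^ s + C * |z + δ - x| ^ s := by
    have hc : Continuous fun t : ℝ => t ^ s := Real.continuous_rpow_const hs.le
    have h1 : Continuous fun δ : ℝ => |z - δ - x| := by fun_prop
    have h2 : Continuous fun δ : ℝ => |z + δ - x| := by fun_prop
    exact ((hc.comp h1).const_mul C).add ((hc.comp h2).const_mul C)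
  have hR0 := (hRc.tendsto 0).mono_left (nhdsWithin_le_nhds (s := Ioi 0))
  have hlim := ((tendsto_levy_sub hb hα z).sub hP0)
  simp only [sub_zero, add_zero, sub_self] at hlim hR0
  have hle := le_of_tendsto_of_tendsto hlim hR0 ?_
  · linarith
  · have hpos : 0 < r - |z - x| := by linarith
    filter_upwards [Ioo_mem_nhdsGT hpos] with δ hδ
    have hz1 := abs_le.1 (le_refl |z - x|)
    have a1 := hP (z - δ) ⟨by linarith [hδ.2, hz1.1], by linarith [hδ.1, hz1.2]⟩
    have a2 := hP (z + δ) ⟨by linarith [hδ.1, hz1.1], by linarith [hδ.2, hz1.2]⟩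
    have b1 := (abs_le.1 a1).2
    have b2 := (abs_le.1 a2).1
    linarith

/-- If `x` is approximable at rate `a`, there are `b`-adic `z = k / b^n` within `b^(-na)` of `x`
that carry a jump of at least `b^(-αn)`. Regularity `s` would make this jump at most `C b^(-nas)`,
which is impossible for large `n` when `a * s > α`. -/
theorem le_of_pointwiseHolder_levy {b : ℕ} (hb : 2 ≤ b) {α : ℝ} (hα : 0 < α) {s x : ℝ}
    (hs : 0 < s) (h : PointwiseHolder s (levy b α) x) : s ≤ α * invExponent b x := by
  by_contra! hlt
  have hb1 : (1 : ℝ) < b := by exact_mod_cast hb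
  have hb0 : (0 : ℝ) < b := by linarith
  obtain ⟨a, ha, has⟩ := exists_mem_approxSet_of_invExponent_lt (b := b) (x := x) (t := s / α)
    (by rw [lt_div_iff₀ hα, mul_comm]; exact hlt)
  have ha0 : 0 < a := zero_lt_one.trans_le ha.1
  have has' : 0 < a * s - α := by
    rw [inv_lt_iff_one_lt_mul₀ ha0, div_mul_eq_mul_div, lt_div_iff₀ hα] at has
    linarith
  obtain ⟨C, r, hr, hJ⟩ := levyJump_le_of_pointwiseHolder hb hα hs h
  have hev := (tendsto_mul_rpow_neg hb C has').eventually_lt_const one_pos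
  have hev2 := (tendsto_mul_rpow_neg hb 1 one_pos).eventually_lt_const hr
  obtain ⟨N, hN⟩ := eventually_atTop.1 (hev.and hev2)
  obtain ⟨n, hn, hnN⟩ := ha.2.exists_gt (max N 1)
  have hn : distInt ((b : ℝ) ^ n * x) ≤ 1 / (b : ℝ) ^ ((n : ℝ) * (a - 1)) := hn
  obtain ⟨hN1, hN2⟩ := hN n (by omega)
  have hbn : (0 : ℝ) < (b : ℝ) ^ n := by positivity
  set z : ℝ := (round ((b : ℝ) ^ n * x) : ℝ) / (b : ℝ) ^ n with hz
  have hzx : |z - x| = distInt ((b : ℝ) ^ n * x) * (b : ℝ) ^ (-(n : ℝ)) := by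
    have : z - x = -(((b : ℝ) ^ n * x - round ((b : ℝ) ^ n * x)) / (b : ℝ) ^ n) := by
      rw [hz]; field_simp; ring
    rw [this, abs_neg, abs_div, abs_of_pos hbn, Real.rpow_neg hb0.le, Real.rpow_natCast, distInt,
      div_eq_mul_inv]
  have hzr : |z - x| < r := by
    rw [hzx]
    refine lt_of_le_of_lt (mul_le_of_le_one_left (by positivity) (distInt_le_one _)) ?_
    simpa using hN2
  have hz2 : |z - x| ≤ (b : ℝ) ^ (-((n : ℝ) * a)) := by
    rw [hzx]
    refine (mul_le_mul_of_nonneg_right hn (by positivity)).trans (le_of_eq ?_)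
    rw [one_div, ← Real.rpow_neg hb0.le, ← Real.rpow_add hb0]
    congr 1; ring
  have h1 := (le_levyJump hb hα (n := n) (by omega) (round ((b : ℝ) ^ n * x))).trans (hJ z hzr)
  have hCpos : 0 < C := by
    by_contra! hC
    have : C * |z - x| ^ s ≤ 0 := mul_nonpos_of_nonpos_of_nonneg hC (by positivity)
    have : 0 < 1 / (b : ℝ) ^ (α * (n : ℝ)) := by positivity
    linarith
  have h2 : 1 / (b : ℝ) ^ (α * (n : ℝ)) ≤ C * (b : ℝ) ^ (-((n : ℝ) * a) * s) := by
    refine h1.trans ?_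
    rw [Real.rpow_mul hb0.le]
    gcongr
  rw [div_le_iff₀ (by positivity), mul_assoc, ← Real.rpow_add hb0] at h2
  have h3 : -((n : ℝ) * a) * s + α * n = -((n : ℝ) * (a * s - α)) := by ring
  rw [h3] at h2
  linarith

theorem exists_pos_le_distInt_of_notMem {b : ℕ} (hb : 2 ≤ b) {a x : ℝ} (ha : 1 ≤ a)
    (h : a ∉ approxSet b x) :
    ∃ c > 0, ∀ n : ℕ, c * (b : ℝ) ^ (-((n : ℝ) * (a - 1))) ≤ distInt ((b : ℝ) ^ n * x) := by
  have hb1 : (1 : ℝ) < b := by exact_mod_cast hb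
  have hb0 : (0 : ℝ) < b := by linarith
  have hfin : {n : ℕ | distInt ((b : ℝ) ^ n * x) ≤ 1 / (b : ℝ) ^ ((n : ℝ) * (a - 1))}.Finite := by
    by_contra hinf
    exact h ⟨ha, hinf⟩
  obtain ⟨N, hN⟩ := hfin.bddAbove
  have hlt : ∀ n, N < n → (b : ℝ) ^ (-((n : ℝ) * (a - 1))) < distInt ((b : ℝ) ^ n * x) := by
    intro n hn
    rw [Real.rpow_neg hb0.le, ← one_div]
    by_contra! hle
    exact absurd (hN hle) (by omega)
  -- A zero distance at `n` would persist at all later positions. Positivity at every `n` lets the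
  -- finitely many exceptional indices be absorbed into `c`.
  have hpos : ∀ n, 0 < distInt ((b : ℝ) ^ n * x) := by
    intro n
    have h1 := hlt (max n (N + 1)) (by omega)
    have h2 := distInt_pow_mul_le b (le_max_left n (N + 1)) x
    have h3 : (0 : ℝ) < (b : ℝ) ^ (-(((max n (N + 1) : ℕ) : ℝ) * (a - 1))) := by positivity
    by_contra! hle
    have := mul_nonpos_of_nonneg_of_nonpos
      (by positivity : (0 : ℝ) ≤ (b : ℝ) ^ (max n (N + 1) - n)) hle
    linarith
  obtain ⟨m, -, hm⟩ := (Finset.range (N + 1)).exists_min_image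
    (fun n => distInt ((b : ℝ) ^ n * x)) ⟨0, by simp⟩
  refine ⟨min 1 (distInt ((b : ℝ) ^ m * x)), lt_min one_pos (hpos m), fun n => ?_⟩
  rcases lt_or_ge N n with hn | hn
  · refine le_trans ?_ (hlt n hn).le
    exact mul_le_of_le_one_left (by positivity) (min_le_left _ _)
  · refine le_trans ?_ (hm n (by simp; omega))
    refine le_trans (mul_le_of_le_one_right (lt_min one_pos (hpos m)).le ?_) (min_le_right _ _)
    apply Real.rpow_le_one_of_one_le_of_nonpos hb1.le
    have : 0 ≤ (n : ℝ) * (a - 1) := mul_nonneg (by positivity) (by linarith)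
    linarith

/-- There are two regimes, separated by the threshold `e = c b^(-na)`. Below it no integer is
crossed and the increment is exactly linear. Above it the increment is at most 1, hence at most
`(|x' - x| / e)^s`. The linear part is kept (`κ = 0`) or subtracted (`κ = 1`) according to whether
`s < 1` or `s > 1`, so that what remains of it is comparable to the power `s` in both regimes. -/
theorem abs_sawtooth_sub_sub_le {b : ℕ} (hb : 2 ≤ b) {a c s x x' κ : ℝ} (ha : 1 ≤ a) (hc : 0 < c)
    (hs : 0 < s) (hκ : κ = 0 ∧ s < 1 ∨ κ = 1 ∧ 1 < s) (n : ℕ)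
    (hx : c * (b : ℝ) ^ (-((n : ℝ) * (a - 1))) ≤ distInt ((b : ℝ) ^ n * x)) :
    |sawtooth ((b : ℝ) ^ n * x') - sawtooth ((b : ℝ) ^ n * x) - κ * ((b : ℝ) ^ n * (x' - x))|
      ≤ (c ^ (-s) + c ^ (1 - s)) * (b : ℝ) ^ ((n : ℝ) * (a * s)) * |x' - x| ^ s := by
  have hb1 : (1 : ℝ) < b := by exact_mod_cast hb
  have hb0 : (0 : ℝ) < b := by linarith
  have hbn : (0 : ℝ) < (b : ℝ) ^ n := by positivity
  set h := |x' - x| with hh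
  have hh0 : 0 ≤ h := abs_nonneg _
  set e : ℝ := c * (b : ℝ) ^ (-((n : ℝ) * a)) with he
  have he0 : 0 < e := by positivity
  have hpow : ∀ t : ℝ, e ^ t = c ^ t * (b : ℝ) ^ (-((n : ℝ) * a) * t) := fun t => by
    rw [he, Real.mul_rpow hc.le (by positivity), ← Real.rpow_mul hb0.le]
  have hcs : 0 < c ^ (-s) := by positivity
  have hcs1 : 0 < c ^ (1 - s) := by positivity
  have hB : 0 < (b : ℝ) ^ ((n : ℝ) * (a * s)) := by positivity
  have hHs : 0 ≤ h ^ s := by positivity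
  have hlin : (b : ℝ) ^ n * e ^ (1 - s) ≤ c ^ (1 - s) * (b : ℝ) ^ ((n : ℝ) * (a * s)) := by
    rw [hpow, mul_left_comm, ← Real.rpow_natCast, ← Real.rpow_add hb0]
    gcongr
    · exact hb1.le
    · have : (0 : ℝ) ≤ n := by positivity
      nlinarith
  rcases lt_or_ge h e with hlt | hge
  · have hdiff : sawtooth ((b : ℝ) ^ n * x') - sawtooth ((b : ℝ) ^ n * x)
        = (b : ℝ) ^ n * (x' - x) := by
      rw [sawtooth_sub_of_lt_distInt, mul_sub]
      refine lt_of_lt_of_le ?_ hx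
      rw [← mul_sub, abs_mul, abs_of_pos hbn]
      have : (b : ℝ) ^ n * e = c * (b : ℝ) ^ (-((n : ℝ) * (a - 1))) := by
        rw [he, mul_left_comm, ← Real.rpow_natCast, ← Real.rpow_add hb0]
        congr 2; ring
      rw [← this]
      gcongr
    rw [hdiff]
    rcases hκ with ⟨rfl, hs1⟩ | ⟨rfl, hs1⟩
    · rw [zero_mul, sub_zero, abs_mul, abs_of_pos hbn]
      have h1 : h = h ^ (1 - s) * h ^ s := by
        rw [← Real.rpow_add' hh0 (by norm_num)]; simp
      have h2 : h ^ (1 - s) ≤ e ^ (1 - s) := Real.rpow_le_rpow hh0 hlt.le (by linarith)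
      calc (b : ℝ) ^ n * h = (b : ℝ) ^ n * h ^ (1 - s) * h ^ s := by rw [mul_assoc, ← h1]
        _ ≤ (b : ℝ) ^ n * e ^ (1 - s) * h ^ s := by gcongr
        _ ≤ c ^ (1 - s) * (b : ℝ) ^ ((n : ℝ) * (a * s)) * h ^ s := by gcongr
        _ ≤ _ := by gcongr; linarith
    · rw [one_mul, sub_self, abs_zero]; positivity
  · have hh1 : 0 < h := he0.trans_le hge
    have hone : 1 ≤ c ^ (-s) * (b : ℝ) ^ ((n : ℝ) * (a * s)) * h ^ s := by
      have h1 : e ^ s ≤ h ^ s := Real.rpow_le_rpow he0.le hge hs.le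
      have h2 : c ^ (-s) * (b : ℝ) ^ ((n : ℝ) * (a * s)) * e ^ s = 1 := by
        rw [hpow, mul_mul_mul_comm, ← Real.rpow_add hc, ← Real.rpow_add hb0]
        have : (n : ℝ) * (a * s) + -((n : ℝ) * a) * s = 0 := by ring
        rw [this]; simp
      rw [← h2]
      gcongr
    have hsaw : |sawtooth ((b : ℝ) ^ n * x') - sawtooth ((b : ℝ) ^ n * x)| ≤ 1 := by
      have h1 := abs_sawtooth_le ((b : ℝ) ^ n * x')
      have h2 := abs_sawtooth_le ((b : ℝ) ^ n * x)
      have h3 := abs_sub (sawtooth ((b : ℝ) ^ n * x')) (sawtooth ((b : ℝ) ^ n * x))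
      linarith
    rw [add_mul, add_mul]
    refine (abs_sub _ _).trans (add_le_add (hsaw.trans hone) ?_)
    rcases hκ with ⟨rfl, hs1⟩ | ⟨rfl, hs1⟩
    · rw [zero_mul, abs_zero]; positivity
    · rw [one_mul, abs_mul, abs_of_pos hbn]
      have h1 : h = h ^ (1 - s) * h ^ s := by
        rw [← Real.rpow_add hh1]; simp
      have h2 : h ^ (1 - s) ≤ e ^ (1 - s) :=
        Real.rpow_le_rpow_of_nonpos he0 hge (by linarith)
      calc (b : ℝ) ^ n * h = (b : ℝ) ^ n * h ^ (1 - s) * h ^ s := by rw [mul_assoc, ← h1]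
        _ ≤ (b : ℝ) ^ n * e ^ (1 - s) * h ^ s := by gcongr
        _ ≤ c ^ (1 - s) * (b : ℝ) ^ ((n : ℝ) * (a * s)) * h ^ s := by gcongr

/-- Summing the termwise bounds gives a geometric series of ratio `b^(a s - α) < 1`. The polynomial
is a constant for `s < 1`. For `s > 1` it has the slope obtained by differentiating termwise, which
converges because `α > a * s > 1`. -/
theorem pointwiseHolder_levy {b : ℕ} (hb : 2 ≤ b) {α : ℝ} (hα : 0 < α) {a s x : ℝ} (ha : 1 ≤ a)
    (hax : a ∉ approxSet b x) (hs : 0 < s) (hs1 : s ≠ 1) (has : a * s < α) :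
    PointwiseHolder s (levy b α) x := by
  have hb1 : (1 : ℝ) < b := by exact_mod_cast hb
  have hb0 : (0 : ℝ) < b := by linarith
  obtain ⟨c, hc, hcx⟩ := exists_pos_le_distInt_of_notMem hb ha hax
  obtain ⟨κ, hκ⟩ : ∃ κ : ℝ, κ = 0 ∧ s < 1 ∨ κ = 1 ∧ 1 < s := by
    rcases hs1.lt_or_gt with h | h
    · exact ⟨0, Or.inl ⟨rfl, h⟩⟩
    · exact ⟨1, Or.inr ⟨rfl, h⟩⟩
  have hsl : Summable fun i : ℕ => κ * ((b : ℝ) ^ (i + 1) / (b : ℝ) ^ (α * ((i + 1 : ℕ) : ℝ))) := by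
    rcases hκ with ⟨rfl, -⟩ | ⟨rfl, h1⟩
    · simp
    · have hα1 : 0 < α - 1 := by nlinarith
      refine (summable_inv_rpow hb hα1).congr fun i => ?_
      rw [one_mul, ← Real.rpow_natCast, ← Real.rpow_sub hb0, one_div, ← Real.rpow_neg hb0.le]
      congr 1; ring
  set A := ∑' i : ℕ, κ * ((b : ℝ) ^ (i + 1) / (b : ℝ) ^ (α * ((i + 1 : ℕ) : ℝ))) with hA
  have hbd : Summable fun i : ℕ => (c ^ (-s) + c ^ (1 - s)) *
      (1 / (b : ℝ) ^ ((α - a * s) * ((i + 1 : ℕ) : ℝ))) :=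
    (summable_inv_rpow hb (by linarith)).mul_left _
  set D := ∑' i : ℕ, (c ^ (-s) + c ^ (1 - s)) *
      (1 / (b : ℝ) ^ ((α - a * s) * ((i + 1 : ℕ) : ℝ))) with hD
  have hD0 : 0 ≤ D := tsum_nonneg fun i => by positivity
  refine ⟨D + 1, by positivity, 1, one_pos,
    Polynomial.C (levy b α x) + Polynomial.C A * Polynomial.X, Or.inr ?_, fun x' _ => ?_⟩
  · rcases hκ with ⟨rfl, -⟩ | ⟨rfl, h1⟩
    · have hA0 : A = 0 := by simp [hA]
      simpa [hA0] using hs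
    · refine lt_of_le_of_lt ?_ h1
      have : (Polynomial.C (levy b α x) + Polynomial.C A * Polynomial.X).natDegree ≤ 1 := by
        compute_degree
      exact_mod_cast this
  · have heval : (Polynomial.C (levy b α x) + Polynomial.C A * Polynomial.X).eval (x' - x)
        = levy b α x + A * (x' - x) := by simp
    have hsum : levy b α x' - (levy b α x + A * (x' - x)) = ∑' i : ℕ,
        (sawtooth ((b : ℝ) ^ (i + 1) * x') - sawtooth ((b : ℝ) ^ (i + 1) * x)
          - κ * ((b : ℝ) ^ (i + 1) * (x' - x))) / (b : ℝ) ^ (α * ((i + 1 : ℕ) : ℝ)) := by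
      rw [← sub_sub, levy, levy, ← (summable_levy hb hα _).tsum_sub (summable_levy hb hα _), hA,
        ← tsum_mul_right, ← Summable.tsum_sub _ (hsl.mul_right _)]
      · congr 1; funext i; ring
      · exact (summable_levy hb hα _).sub (summable_levy hb hα _)
    rw [heval, hsum]
    have hfin := tsum_of_norm_bounded (hbd.mul_right (|x' - x| ^ s)).hasSum (f := fun i : ℕ =>
        (sawtooth ((b : ℝ) ^ (i + 1) * x') - sawtooth ((b : ℝ) ^ (i + 1) * x)
          - κ * ((b : ℝ) ^ (i + 1) * (x' - x))) / (b : ℝ) ^ (α * ((i + 1 : ℕ) : ℝ))) (fun i => ?_)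
    · rw [Real.norm_eq_abs, tsum_mul_right] at hfin
      refine hfin.trans ?_
      gcongr
      linarith
    · have h := abs_sawtooth_sub_sub_le hb (x' := x') ha hc hs hκ (i + 1) (hcx (i + 1))
      have hW : (0 : ℝ) < (b : ℝ) ^ (α * ((i + 1 : ℕ) : ℝ)) := by positivity
      rw [Real.norm_eq_abs, abs_div, abs_of_pos hW, div_le_iff₀ hW]
      refine h.trans (le_of_eq ?_)
      have : (b : ℝ) ^ (((i + 1 : ℕ) : ℝ) * (a * s)) =
          1 / (b : ℝ) ^ ((α - a * s) * ((i + 1 : ℕ) : ℝ)) * (b : ℝ) ^ (α * ((i + 1 : ℕ) : ℝ)) := by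
        rw [one_div, ← Real.rpow_neg hb0.le, ← Real.rpow_add hb0]
        congr 1; ring
      rw [this]; ring

theorem holderExponent_levy {b : ℕ} (hb : 2 ≤ b) {α : ℝ} (hα : 0 < α) (x : ℝ) :
    holderExponent (levy b α) x = ((α * invExponent b x : ℝ) : EReal) := by
  have hw0 := invExponent_nonneg b x
  unfold holderExponent
  apply le_antisymm
  · refine sSup_le ?_
    rintro _ ⟨s, hs, hP, rfl⟩
    rw [EReal.coe_le_coe_iff]
    rcases hs.eq_or_lt with rfl | hs
    · positivity
    · exact le_of_pointwiseHolder_levy hb hα hs hP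
  · rcases hw0.eq_or_lt with h0 | h0
    · refine le_sSup ⟨0, le_rfl, ?_, by simp [← h0]⟩
      refine ⟨(∑' i : ℕ, 1 / (b : ℝ) ^ (α * ((i + 1 : ℕ) : ℝ))) + 1, ?_, 1, one_pos, 0, Or.inl rfl,
        fun z _ => ?_⟩
      · have := (abs_nonneg _).trans (abs_levy_le hb hα 0)
        linarith
      · simp only [Polynomial.eval_zero, sub_zero, Real.rpow_zero, mul_one]
        linarith [abs_levy_le hb hα z]
    · refine le_of_forall_lt fun t ht => ?_
      obtain ⟨d, hd, hd'⟩ := EReal.lt_iff_exists_real_btwn.1 ht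
      rw [EReal.coe_lt_coe_iff] at hd'
      have hpos : 0 < α * invExponent b x := by positivity
      -- Avoiding `s = 1` is harmless, since only a supremum is computed.
      obtain ⟨s, hs, hs1⟩ : ∃ s ∈ Ioo (max d 0) (α * invExponent b x), s ≠ 1 := by
        obtain ⟨s₁, h1, h2⟩ := exists_between (max_lt hd' hpos)
        obtain ⟨s₂, h3, h4⟩ := exists_between h2
        by_cases h : s₁ = 1
        · exact ⟨s₂, ⟨h1.trans h3, h4⟩, by rintro rfl; linarith⟩
        · exact ⟨s₁, ⟨h1, h2⟩, h⟩
      have hs0 : 0 < s := (le_max_right _ _).trans_lt hs.1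
      have hsw : s / α < invExponent b x := by
        rw [div_lt_iff₀ hα, mul_comm]; exact hs.2
      obtain ⟨v, hv, hv'⟩ := exists_between hsw
      have hv0 : 0 < v := (div_pos hs0 hα).trans hv
      have hmem : PointwiseHolder s (levy b α) x := by
        refine pointwiseHolder_levy hb hα (a := v⁻¹) ?_ ?_ hs0 hs1 ?_
        · exact (one_le_inv₀ hv0).2 (hv'.le.trans (invExponent_le_one b x))
        · intro hm
          have := invExponent_le_inv hm
          rw [inv_inv] at this
          linarith
        · rw [inv_mul_lt_iff₀ hv0, ← div_lt_iff₀ hα]; exact hv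
      refine hd.trans (lt_of_lt_of_le ?_ (le_sSup ⟨s, hs0.le, hmem, rfl⟩))
      rw [EReal.coe_lt_coe_iff]
      exact (le_max_left _ _).trans_lt hs.1

theorem holderExponent_levyTranslate {b : ℕ} (hb : 2 ≤ b) {α : ℝ} (hα : 0 < α) (y x : ℝ) :
    holderExponent (levyTranslate b α y) x = ((α * invExponent b (x - y) : ℝ) : EReal) := by
  rw [← holderExponent_levy hb hα]
  have : ∀ s, PointwiseHolder s (levyTranslate b α y) x ↔ PointwiseHolder s (levy b α) (x - y) := by
    intro s
    unfold PointwiseHolder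
    refine exists_congr fun C => and_congr_right fun _ => exists_congr fun r =>
      and_congr_right fun _ => exists_congr fun P => and_congr_right fun _ => ⟨fun h z hz => ?_,
        fun h z hz => ?_⟩
    · have := h (z + y) ⟨by linarith [hz.1], by linarith [hz.2]⟩
      have e : z + y - x = z - (x - y) := by ring
      rw [e] at this
      simpa [levyTranslate, levy] using this
    · have := h (z - y) ⟨by linarith [hz.1], by linarith [hz.2]⟩
      have e : z - y - (x - y) = z - x := by ring
      rw [e] at this
      simpa [levyTranslate, levy] using this
  simp only [holderExponent, this]

theorem levelSet_levy {b : ℕ} (hb : 2 ≤ b) {α₁ α₂ : ℝ} (hα₁ : 0 < α₁) (hα₂ : 0 < α₂)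
    (y H₁ H₂ : ℝ) :
    levelSet (levy b α₁) (levyTranslate b α₂ y) H₁ H₂ =
      {x | invExponent b x = H₁ / α₁ ∧ invExponent b (x - y) = H₂ / α₂} := by
  ext x
  simp only [levelSet, mem_ofPred_eq, holderExponent_levy hb hα₁, holderExponent_levyTranslate hb hα₂,
    EReal.coe_eq_coe_iff, eq_div_iff hα₁.ne', eq_div_iff hα₂.ne', mul_comm]

/-! ### The upper bound for the dimension -/

open MeasureTheory in
-- Borel–Cantelli covering: level `n` needs on the order of `b^n` intervals of radius `b^(-na)`
-- around the fractions `k / b^n`, and `∑ b^n b^(-nad)` converges because `a * d > 1`. The cover `t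
-- N` uses all levels from `N` on, and its cost is a tail of this series.
theorem hausdorffMeasure_approx_eq_zero {b : ℕ} (hb : 2 ≤ b) {a d : ℝ} (ha : 1 ≤ a) (hd : 0 < d)
    (had : 1 < a * d) (R : ℕ) :
    Measure.hausdorffMeasure d {x : ℝ | |x| ≤ R ∧ a ∈ approxSet b x} = 0 := by
  have hb1 : (1 : ℝ) < b := by exact_mod_cast hb
  have hb0 : (0 : ℝ) < b := by linarith
  let M : ℕ → ℕ := fun n => (R + 1) * b ^ n
  let ρ : ℕ → ℝ := fun n => (b : ℝ) ^ (-((n : ℝ) * a))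
  let t : ℕ → ℕ × ℤ → Set ℝ := fun N p =>
    if p.2 ∈ Finset.Icc (-(M (p.1 + N) : ℤ)) (M (p.1 + N)) then
      Icc (p.2 / (b : ℝ) ^ (p.1 + N) - ρ (p.1 + N)) (p.2 / (b : ℝ) ^ (p.1 + N) + ρ (p.1 + N))
    else ∅
  have hdiam : ∀ N p, Metric.ediam (t N p) ≤ ENNReal.ofReal (2 * ρ (p.1 + N)) := by
    intro N p
    simp only [t]
    split_ifs
    · rw [Real.ediam_Icc]
      apply ENNReal.ofReal_le_ofReal
      linarith
    · simp
  have hρ0 : ∀ n, 0 < ρ n := fun n => by positivity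
  have hρmono : ∀ n N, ρ (n + N) ≤ ρ N := by
    intro n N
    apply Real.rpow_le_rpow_of_exponent_le hb1.le
    push_cast
    have : 0 ≤ (n : ℝ) * a := by positivity
    linarith
  have hle := Measure.hausdorffMeasure_le_liminf_tsum d
    {x : ℝ | |x| ≤ R ∧ a ∈ approxSet b x} (l := atTop) (fun N => ENNReal.ofReal (2 * ρ N))
    ?_ t (Eventually.of_forall fun N p => (hdiam N p).trans ?_) (Eventually.of_forall fun N => ?_)
  · refine le_antisymm (hle.trans ?_) zero_le
    let q : ℝ := (b : ℝ) ^ (1 - a * d)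
    have hq0 : 0 < q := by positivity
    have hq1 : q < 1 := Real.rpow_lt_one_of_one_lt_of_neg hb1 (by linarith)
    let g : ℕ → ENNReal := fun n => ENNReal.ofReal (3 * (R + 1) * 2 ^ d * q ^ n)
    have hg : ∑' n, g n ≠ ⊤ := by
      have hs : Summable fun n => 3 * (R + 1) * 2 ^ d * q ^ n :=
        (summable_geometric_of_lt_one hq0.le hq1).mul_left _
      rw [← ENNReal.ofReal_tsum_of_nonneg (fun n => by positivity) hs]
      exact ENNReal.ofReal_ne_top
    have hsum : ∀ N, ∑' p, Metric.ediam (t N p) ^ d ≤ ∑' n, g (n + N) := by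
      intro N
      rw [ENNReal.tsum_prod']
      refine ENNReal.tsum_le_tsum fun n => ?_
      rw [tsum_eq_sum (s := Finset.Icc (-(M (n + N) : ℤ)) (M (n + N)))]
      · refine (Finset.sum_le_card_nsmul _ _ (ENNReal.ofReal (2 * ρ (n + N)) ^ d) fun k _ =>
          ENNReal.rpow_le_rpow (hdiam N (n, k)) hd.le).trans ?_
        rw [Int.card_Icc, nsmul_eq_mul, ENNReal.ofReal_rpow_of_nonneg (by positivity) hd.le,
          ← ENNReal.ofReal_natCast, ← ENNReal.ofReal_mul (by positivity)]
        apply ENNReal.ofReal_le_ofReal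
        have hcard : (((M (n + N) : ℤ) + 1 - -(M (n + N) : ℤ)).toNat : ℝ)
            ≤ 3 * ((R + 1) * (b : ℝ) ^ (n + N)) := by
          have h1 : ((M (n + N) : ℤ) + 1 - -(M (n + N) : ℤ)).toNat = 2 * M (n + N) + 1 := by omega
          have h2 : 1 ≤ M (n + N) := Nat.one_le_iff_ne_zero.2 (by positivity)
          rw [h1]
          have h3 : 2 * M (n + N) + 1 ≤ 3 * M (n + N) := by omega
          have h4 : ((2 * M (n + N) + 1 : ℕ) : ℝ) ≤ ((3 * M (n + N) : ℕ) : ℝ) := by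
            exact_mod_cast h3
          refine h4.trans (le_of_eq ?_)
          simp [M]
        refine (mul_le_mul_of_nonneg_right hcard (by positivity)).trans (le_of_eq ?_)
        rw [Real.mul_rpow (by norm_num) (hρ0 _).le]
        have : q ^ (n + N) = (b : ℝ) ^ (n + N) * ρ (n + N) ^ d := by
          simp only [q, ρ]
          rw [← Real.rpow_mul_natCast hb0.le, ← Real.rpow_mul hb0.le, ← Real.rpow_natCast,
            ← Real.rpow_add hb0]
          congr 1; ring
        rw [this]; ring
      · intro k hk
        simp only [t]
        rw [if_neg hk]
        simp [hd]
    have hlim := ENNReal.tendsto_sum_nat_add g hg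
    rw [← hlim.liminf_eq]
    exact liminf_le_liminf (Eventually.of_forall hsum)
  · have h := tendsto_mul_rpow_neg hb 2 (c := a) (by linarith)
    simpa [ρ] using ENNReal.tendsto_ofReal h
  · apply ENNReal.ofReal_le_ofReal
    linarith [hρmono p.1 N]
  · rintro x ⟨hxR, hxa⟩
    obtain ⟨n, hn, hnN⟩ := hxa.2.exists_gt N
    have hn : distInt ((b : ℝ) ^ n * x) ≤ 1 / (b : ℝ) ^ ((n : ℝ) * (a - 1)) := hn
    have hbn : (0 : ℝ) < (b : ℝ) ^ n := by positivity
    obtain ⟨m, rfl⟩ : ∃ m, n = m + N := ⟨n - N, by omega⟩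
    have hk : round ((b : ℝ) ^ (m + N) * x) ∈ Finset.Icc (-(M (m + N) : ℤ)) (M (m + N)) := by
      have h1 := abs_sub_round ((b : ℝ) ^ (m + N) * x)
      have h2 : |(b : ℝ) ^ (m + N) * x| ≤ (b : ℝ) ^ (m + N) * R := by
        rw [abs_mul, abs_of_pos hbn]; gcongr
      have h3 : (1 : ℝ) ≤ (b : ℝ) ^ (m + N) := one_le_pow₀ hb1.le
      rw [abs_le] at h1 h2
      have hM : ((M (m + N) : ℤ) : ℝ) = (b : ℝ) ^ (m + N) * R + (b : ℝ) ^ (m + N) := by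
        simp only [M]; push_cast; ring
      rw [Finset.mem_Icc]
      constructor
      · have : (-((M (m + N) : ℤ) : ℝ)) ≤ round ((b : ℝ) ^ (m + N) * x) := by
          rw [hM]; linarith [h1.2, h2.1]
        exact_mod_cast this
      · have : (round ((b : ℝ) ^ (m + N) * x) : ℝ) ≤ ((M (m + N) : ℤ) : ℝ) := by
          rw [hM]; linarith [h1.1, h2.2]
        exact_mod_cast this
    refine mem_iUnion.2 ⟨(m, round ((b : ℝ) ^ (m + N) * x)), ?_⟩
    simp only [t]
    rw [if_pos hk]
    have hρ : ρ (m + N) * (b : ℝ) ^ (m + N) = 1 / (b : ℝ) ^ (((m + N : ℕ) : ℝ) * (a - 1)) := by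
      simp only [ρ]
      rw [one_div, ← Real.rpow_neg hb0.le, ← Real.rpow_natCast, ← Real.rpow_add hb0]
      congr 1; ring
    rw [← hρ, distInt, abs_le] at hn
    constructor
    · rw [sub_le_iff_le_add, div_le_iff₀ hbn]; linarith [hn.1]
    · rw [← sub_le_iff_le_add, le_div_iff₀ hbn]; linarith [hn.2]

theorem mem_approxSet_of_le {b : ℕ} (hb : 2 ≤ b) {x a a' : ℝ} (ha : 1 ≤ a) (haa : a ≤ a')
    (h : a' ∈ approxSet b x) : a ∈ approxSet b x := by
  refine ⟨ha, h.2.mono ?_⟩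
  intro n hn
  refine le_trans (show distInt ((b : ℝ) ^ n * x) ≤ 1 / (b : ℝ) ^ ((n : ℝ) * (a' - 1)) from hn) ?_
  have hb1 : (1 : ℝ) ≤ b := by exact_mod_cast (by omega : 1 ≤ b)
  gcongr

theorem dimH_invExponent_le {b : ℕ} (hb : 2 ≤ b) {u : ℝ} (hu : 0 ≤ u) :
    dimH {x : ℝ | invExponent b x ≤ u} ≤ ENNReal.ofReal u := by
  lift u to NNReal using hu
  rcases le_or_gt 1 (u : ℝ) with h1 | h1
  · refine (dimH_mono (subset_univ _)).trans ?_
    rw [Real.dimH_univ_eq_finrank]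
    simpa using h1
  · refine ENNReal.le_of_forall_pos_le_add fun ε hε _ => ?_
    -- The bound `d < 1` makes `d⁻¹` an admissible rate, and `d < u + ε` makes the measure of
    -- dimension `u + ε` vanish.
    obtain ⟨d, hd, hd'⟩ := exists_between (lt_min h1 (lt_add_of_pos_right (u : ℝ) (NNReal.coe_pos.2 hε)))
    have hd0 : 0 < d := u.coe_nonneg.trans_lt hd
    have hsub : {x : ℝ | invExponent b x ≤ u} ⊆
        ⋃ R : ℕ, {x : ℝ | |x| ≤ R ∧ d⁻¹ ∈ approxSet b x} := by
      intro x hx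
      obtain ⟨R, hR⟩ := exists_nat_ge |x|
      obtain ⟨a, ha, had⟩ := exists_mem_approxSet_of_invExponent_lt (lt_of_le_of_lt hx hd)
      refine mem_iUnion.2 ⟨R, hR, mem_approxSet_of_le hb ?_ ?_ ha⟩
      · exact (one_le_inv₀ hd0).2 (hd'.le.trans (min_le_left _ _))
      · exact (inv_le_comm₀ hd0 (by linarith [ha.1])).2 had.le
    refine (dimH_mono hsub).trans ?_
    rw [dimH_iUnion]
    refine iSup_le fun R => ?_
    have hz := hausdorffMeasure_approx_eq_zero hb (a := d⁻¹) (d := u + ε)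
      ((one_le_inv₀ hd0).2 (hd'.le.trans (min_le_left _ _))) (by positivity)
      (by rw [inv_mul_eq_div, one_lt_div hd0]; exact hd'.trans_le (min_le_right _ _)) R
    have := dimH_le_of_hausdorffMeasure_ne_top (d := u + ε)
      (s := {x : ℝ | |x| ≤ R ∧ d⁻¹ ∈ approxSet b x}) (by
        rw [NNReal.coe_add, hz]; simp)
    refine this.trans (le_of_eq ?_)
    rw [ENNReal.coe_add, ENNReal.ofReal_coe_nnreal]

theorem dimH_invExponent_sub_le {b : ℕ} (hb : 2 ≤ b) (y : ℝ) {v : ℝ} (hv : 0 ≤ v) :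
    dimH {x : ℝ | invExponent b (x - y) ≤ v} ≤ ENNReal.ofReal v := by
  have h := (IsometryEquiv.subRight y).dimH_preimage {x : ℝ | invExponent b x ≤ v}
  exact h.le.trans (dimH_invExponent_le hb hv)

/-! ### Digit expansions -/

theorem distInt_intCast_add (k : ℤ) (x : ℝ) : distInt (k + x) = distInt x := by
  simp [distInt, round_intCast_add]

theorem exists_pow_mul_ofDigits_eq {b : ℕ} (hb : 2 ≤ b) (d : ℕ → Fin b) (n : ℕ) :
    ∃ k : ℤ, (b : ℝ) ^ n * Real.ofDigits d = k + Real.ofDigits fun i => d (i + n) := by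
  have hb0 : (b : ℝ) ≠ 0 := by positivity
  refine ⟨∑ i ∈ Finset.range n, (d i : ℤ) * (b : ℤ) ^ (n - (i + 1)), ?_⟩
  rw [Real.ofDigits_eq_sum_add_ofDigits d n, mul_add, mul_inv_cancel_left₀ (by positivity),
    Finset.mul_sum]
  congr 1
  push_cast
  refine Finset.sum_congr rfl fun i hi => ?_
  have hi : i + 1 ≤ n := by simpa using hi
  rw [Real.ofDigitsTerm, mul_left_comm, pow_sub₀ _ hb0 hi]

theorem distInt_pow_mul_ofDigits {b : ℕ} (hb : 2 ≤ b) (d : ℕ → Fin b) (n : ℕ) :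
    distInt ((b : ℝ) ^ n * Real.ofDigits d) = distInt (Real.ofDigits fun i => d (i + n)) := by
  obtain ⟨k, hk⟩ := exists_pow_mul_ofDigits_eq hb d n
  rw [hk, distInt_intCast_add]

theorem ofDigits_eq_head_add {b : ℕ} (d : ℕ → Fin b) :
    Real.ofDigits d = ((d 0 : ℕ) + Real.ofDigits fun i => d (i + 1)) / b := by
  rw [Real.ofDigits_eq_sum_add_ofDigits d 1]
  simp [Real.ofDigitsTerm]
  ring

theorem distInt_pow_mul_sub_le {b : ℕ} (hb : 2 ≤ b) {d d' : ℕ → Fin b} {n e : ℕ} (hne : n ≤ e)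
    (h : ∀ i, n ≤ i → i < e → d i = d' i) :
    distInt ((b : ℝ) ^ n * (Real.ofDigits d - Real.ofDigits d')) ≤ (b : ℝ) ^ ((n : ℝ) - e) := by
  have hb0 : (0 : ℝ) < b := by positivity
  obtain ⟨k, hk⟩ := exists_pow_mul_ofDigits_eq hb d n
  obtain ⟨k', hk'⟩ := exists_pow_mul_ofDigits_eq hb d' n
  have h1 : (b : ℝ) ^ n * (Real.ofDigits d - Real.ofDigits d') = ((k - k' : ℤ) : ℝ) +
      ((Real.ofDigits fun i => d (i + n)) - Real.ofDigits fun i => d' (i + n)) := by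
    rw [mul_sub, hk, hk']; push_cast; ring
  rw [h1, distInt_intCast_add]
  refine (distInt_le_abs _).trans ((Real.abs_ofDigits_sub_ofDigits_le (n := e - n)
    fun i hi => h _ (by omega) (by omega)).trans (le_of_eq ?_))
  rw [← Real.rpow_natCast, ← Real.rpow_neg hb0.le, Nat.cast_sub hne]
  congr 1; ring

theorem distInt_pow_mul_ofDigits_le {b : ℕ} (hb : 2 ≤ b) {d : ℕ → Fin b} {n e : ℕ} (hne : n ≤ e)
    (h : ∀ i, n ≤ i → i < e → (d i : ℕ) = 0) :
    distInt ((b : ℝ) ^ n * Real.ofDigits d) ≤ (b : ℝ) ^ ((n : ℝ) - e) := by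
  have h0 : Real.ofDigits (fun _ => (⟨0, by omega⟩ : Fin b)) = 0 := by
    simp [Real.ofDigits, Real.ofDigitsTerm]
  have := distInt_pow_mul_sub_le hb (d' := fun _ => (⟨0, by omega⟩ : Fin b)) hne
    fun i h1 h2 => Fin.ext (h i h1 h2)
  rwa [h0, sub_zero] at this

/-- The digits `0, 1` place the shifted number in `[1/b², 2/b²]` whatever follows, so it is far from
both 0 and 1 even if the tail consists of digits `b - 1`. -/
theorem le_distInt_pow_mul_of_zero_one {b : ℕ} (hb : 2 ≤ b) {d : ℕ → Fin b} {n : ℕ}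
    (h0 : (d n : ℕ) = 0) (h1 : (d (n + 1) : ℕ) = 1) :
    1 / (b : ℝ) ^ 2 ≤ distInt ((b : ℝ) ^ n * Real.ofDigits d) := by
  have hb2 : (2 : ℝ) ≤ b := by exact_mod_cast hb
  have hb0 : (0 : ℝ) < b := by linarith
  rw [distInt_pow_mul_ofDigits hb, ofDigits_eq_head_add, ofDigits_eq_head_add]
  simp only [zero_add, h0, add_comm 1 n, h1, Nat.cast_zero, Nat.cast_one]
  set t := Real.ofDigits fun i => d (i + 1 + 1 + n) with ht
  have ht0 : 0 ≤ t := Real.ofDigits_nonneg _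
  have ht1 : t ≤ 1 := Real.ofDigits_le_one _
  have e1 : (1 + t) / (b : ℝ) / b = (1 + t) / (b : ℝ) ^ 2 := by rw [div_div, sq]
  rw [e1]
  apply le_distInt_of_le_of_le
  · gcongr; linarith
  · rw [le_sub_iff_add_le, ← add_div, div_le_one (by positivity)]
    nlinarith

theorem le_distInt_pow_mul_of_one_zero_zero {b : ℕ} (hb : 2 ≤ b) {d : ℕ → Fin b} {n : ℕ}
    (h0 : (d n : ℕ) = 1) (h1 : (d (n + 1) : ℕ) = 0) (h2 : (d (n + 2) : ℕ) = 0) :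
    1 / (b : ℝ) ^ 2 ≤ distInt ((b : ℝ) ^ n * Real.ofDigits d) := by
  have hb2 : (2 : ℝ) ≤ b := by exact_mod_cast hb
  have hb0 : (0 : ℝ) < b := by linarith
  rw [distInt_pow_mul_ofDigits hb, ofDigits_eq_head_add, ofDigits_eq_head_add,
    ofDigits_eq_head_add]
  simp only [zero_add, h0, add_comm 1 n, h1, Nat.cast_zero, Nat.cast_one,
    show 1 + 1 + n = n + 2 by ring, h2]
  set t := Real.ofDigits fun i => d (i + 1 + 1 + 1 + n) with ht
  have ht0 : 0 ≤ t := Real.ofDigits_nonneg _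
  have ht1 : t ≤ 1 := Real.ofDigits_le_one _
  have e1 : (1 + t / (b : ℝ) / b) / b = ((b : ℝ) ^ 2 + t) / (b : ℝ) ^ 3 := by field_simp
  have e2 : 1 / (b : ℝ) ^ 2 = b / (b : ℝ) ^ 3 := by field_simp
  rw [e1, e2]
  apply le_distInt_of_le_of_le
  · gcongr; nlinarith
  · rw [le_sub_iff_add_le, ← add_div, div_le_one (by positivity)]
    nlinarith [mul_nonneg hb0.le (sub_nonneg.2 hb2), mul_nonneg (sq_nonneg (b : ℝ)) (sub_nonneg.2 hb2)]

theorem ofDigits_le_of_eq_zero {b : ℕ} (hb : 2 ≤ b) {d : ℕ → Fin b} {i j : ℕ} (hij : i < j)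
    (h : (d i : ℕ) = 0) : Real.ofDigits d ≤ 1 - 1 / (b : ℝ) ^ j := by
  have hb2 : (2 : ℝ) ≤ b := by exact_mod_cast hb
  have hb0 : (0 : ℝ) < b := by linarith
  induction i generalizing d j with
  | zero =>
    have h1 : Real.ofDigits d ≤ 1 / b := by
      rw [ofDigits_eq_head_add, h]
      have := Real.ofDigits_le_one fun i => d (i + 1)
      gcongr
      simpa using this
    have h2 : 1 / (b : ℝ) ≤ 1 / 2 := by gcongr
    have h3 : 1 / (b : ℝ) ^ j ≤ 1 / (b : ℝ) := by
      gcongr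
      calc (b : ℝ) = (b : ℝ) ^ 1 := (pow_one _).symm
        _ ≤ (b : ℝ) ^ j := pow_le_pow_right₀ (by linarith) hij
    linarith
  | succ i ih =>
    obtain ⟨j, rfl⟩ : ∃ j', j = j' + 1 := ⟨j - 1, by omega⟩
    have h1 := ih (d := fun i => d (i + 1)) (j := j) (by omega) h
    have h2 : ((d 0 : ℕ) : ℝ) ≤ b - 1 := by
      have : (d 0 : ℕ) + 1 ≤ b := (d 0).2
      have : (((d 0 : ℕ) + 1 : ℕ) : ℝ) ≤ b := by exact_mod_cast this
      push_cast at this; linarith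
    rw [ofDigits_eq_head_add, div_le_iff₀ hb0]
    have h3 : (1 - 1 / (b : ℝ) ^ (j + 1)) * b = b - 1 / (b : ℝ) ^ j := by
      rw [pow_succ]; field_simp
    rw [h3]; linarith

/-- Expansions that first differ at the index `n`, where both have a digit `0` among the `j` digits
that follow, are at distance at least `1 / b ^ (n + 1 + j)`. -/
theorem le_abs_ofDigits_sub {b : ℕ} (hb : 2 ≤ b) {d d' : ℕ → Fin b} {n j : ℕ}
    (heq : ∀ i < n, d i = d' i) (hne : d n ≠ d' n)
    (h : ∃ i < j, (d (n + 1 + i) : ℕ) = 0) (h' : ∃ i < j, (d' (n + 1 + i) : ℕ) = 0) :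
    1 / (b : ℝ) ^ (n + 1 + j) ≤ |Real.ofDigits d - Real.ofDigits d'| := by
  have hb0 : (0 : ℝ) < b := by positivity
  wlog hlt : d' n < d n generalizing d d'
  · rw [abs_sub_comm]
    exact this (fun i hi => (heq i hi).symm) hne.symm h' h
      (lt_of_le_of_ne (not_lt.1 hlt) hne)
  obtain ⟨i, hi, hdi⟩ := h'
  -- Only the tail of the smaller number must stay away from 1. The zero digit of the larger one
  -- serves to keep the hypotheses symmetric.
  have ht := ofDigits_le_of_eq_zero hb (d := fun i => d' (i + (n + 1))) hi (by
    rwa [add_comm] at hdi)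
  have ht0 := Real.ofDigits_nonneg fun i => d (i + (n + 1))
  rw [Real.ofDigits_eq_sum_add_ofDigits d (n + 1), Real.ofDigits_eq_sum_add_ofDigits d' (n + 1),
    Finset.sum_range_succ, Finset.sum_range_succ]
  have hsum : ∑ i ∈ Finset.range n, Real.ofDigitsTerm d i
      = ∑ i ∈ Finset.range n, Real.ofDigitsTerm d' i :=
    Finset.sum_congr rfl fun i hi => by simp [Real.ofDigitsTerm, heq i (Finset.mem_range.1 hi)]
  have hd : ((d' n : ℕ) : ℝ) + 1 ≤ (d n : ℕ) := by
    have : (d' n : ℕ) + 1 ≤ (d n : ℕ) := hlt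
    exact_mod_cast this
  rw [hsum, le_abs]
  left
  simp only [Real.ofDigitsTerm]
  have hB : (0 : ℝ) < ((b : ℝ) ^ (n + 1))⁻¹ := by positivity
  have e : 1 / (b : ℝ) ^ (n + 1 + j) = ((b : ℝ) ^ (n + 1))⁻¹ * (1 / (b : ℝ) ^ j) := by
    rw [pow_add]; field_simp
  rw [e]
  nlinarith

/-! ### Lacunary expansions -/

/-- The digits `θ` are `0` except for a digit `1` just before each index `lam i`, `i ≥ 1`, where the
indices `lam i` grow geometrically with ratio `η`, up to a bounded error. -/
structure IsLacunary {b : ℕ} (η C : ℝ) (lam : ℕ → ℕ) (θ : ℕ → Fin b) : Prop where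
  one_lt : 1 < η
  nonneg : 0 ≤ C
  zero : lam 0 = 0
  strictMono : StrictMono lam
  le_mul : ∀ i, (lam (i + 1) : ℝ) ≤ η * lam i + C
  mul_le : ∀ i, η * lam i ≤ lam (i + 1) + C
  digit_one : ∀ i, (θ (lam (i + 1) - 1) : ℕ) = 1
  digit_zero : ∀ i n, lam i ≤ n → n + 1 < lam (i + 1) → (θ n : ℕ) = 0

theorem block_length {η : ℝ} {m m' : ℕ} (h : m' = ⌊(m : ℝ) * η⌋₊) (hlt : m < m') :
    (block η m).length = m' - m := by
  simp only [block, ← h, List.length_append, List.length_replicate, List.length_singleton]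
  omega

/-- The block of index `i` occupies the positions from `l i - l 0` to `l (i + 1) - l 0`. In the
error constant, `(η - 1) * l 0` comes from the shift by `l 0` and `1` from the floor. -/
theorem isLacunary_of_isConcatenation {b : ℕ} {η : ℝ} (hη : 1 < η) {l : ℕ → ℕ}
    (hl_mono : StrictMono l) (hl : ∀ i, l (i + 1) = ⌊(l i : ℝ) * η⌋₊) {θ : ℕ → Fin b}
    (hθ : IsConcatenation (fun i => block η (l i)) (fun n => (θ n : ℕ))) :
    IsLacunary η ((η - 1) * l 0 + 1) (fun i => l i - l 0) θ := by
  have hlen : ∀ k, ((List.range k).flatMap fun i => block η (l i)).length = l k - l 0 := by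
    intro k
    induction k with
    | zero => simp
    | succ k ih =>
      rw [List.range_succ, List.flatMap_append, List.length_append, ih]
      simp only [List.flatMap_singleton]
      rw [block_length (hl k) (hl_mono k.lt_succ_self)]
      have h1 := hl_mono.monotone (Nat.zero_le k)
      have h2 := hl_mono k.lt_succ_self
      simp only [Nat.succ_eq_add_one] at h2
      omega
  have hdig : ∀ k n, l k - l 0 ≤ n → n < l (k + 1) - l 0 →
      (block η (l k))[n - (l k - l 0)]? = some (θ n : ℕ) := by
    intro k n h1 h2
    have h := hθ (k + 1) n (by rw [hlen]; exact h2)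
    rw [List.range_succ, List.flatMap_append, List.getElem?_append_right (by rw [hlen]; exact h1),
      hlen] at h
    simpa using h
  have hmono : ∀ i, l 0 ≤ l i := fun i => hl_mono.monotone (Nat.zero_le i)
  have hfl : ∀ i, (l (i + 1) : ℝ) ≤ l i * η ∧ (l i : ℝ) * η < l (i + 1) + 1 := by
    intro i
    rw [hl i]
    exact ⟨Nat.floor_le (by positivity), Nat.lt_floor_add_one _⟩
  have hstep : ∀ i, l i < l (i + 1) := fun i => hl_mono i.lt_succ_self
  refine ⟨hη, ?_, by simp, ?_, ?_, ?_, ?_, ?_⟩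
  · have : 0 ≤ (η - 1) * l 0 := mul_nonneg (by linarith) (by positivity)
    linarith
  · intro i j hij
    have h1 := hl_mono hij
    have h2 := hmono i
    change l i - l 0 < l j - l 0
    omega
  · intro i
    rw [Nat.cast_sub (hmono _), Nat.cast_sub (hmono _)]
    have := (hfl i).1
    linarith
  · intro i
    rw [Nat.cast_sub (hmono _), Nat.cast_sub (hmono _)]
    have := (hfl i).2
    nlinarith
  · intro i
    have h1 := hstep i
    have h2 := hmono i
    have h := hdig i (l (i + 1) - l 0 - 1) (by omega) (by omega)
    rw [block, ← hl i, List.getElem?_append_right (by simp; omega)] at h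
    have e : l (i + 1) - l 0 - 1 - (l i - l 0)
        - (List.replicate (l (i + 1) - l i - 1) 0).length = 0 := by
      rw [List.length_replicate]; omega
    rw [e] at h
    simpa using h.symm
  · intro i n h1 h2
    have h3 := hstep i
    have h4 := hmono i
    have h := hdig i n h1 (by omega)
    rw [block, ← hl i, List.getElem?_append_left (by simp; omega)] at h
    rw [List.getElem?_replicate, if_pos (by omega)] at h
    simpa using h.symm

namespace IsLacunary

variable {b : ℕ} {η C : ℝ} {lam : ℕ → ℕ} {θ : ℕ → Fin b}

theorem exists_le_lt (h : IsLacunary η C lam θ) (n : ℕ) : ∃ i, lam i ≤ n ∧ n < lam (i + 1) := by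
  classical
  have hex : ∃ i, n < lam (i + 1) := ⟨n, (Nat.lt_succ_self n).trans_le (h.strictMono.le_apply)⟩
  refine ⟨Nat.find hex, ?_, Nat.find_spec hex⟩
  rcases hi : Nat.find hex with _ | i
  · rw [h.zero]; exact Nat.zero_le n
  · exact not_lt.1 (Nat.find_min hex (m := i) (by omega))

theorem distInt_le (h : IsLacunary η C lam θ) (hb : 2 ≤ b) {i n : ℕ} (h1 : lam i ≤ n)
    (h2 : n < lam (i + 1)) :
    distInt ((b : ℝ) ^ n * Real.ofDigits θ) ≤ b * (b : ℝ) ^ ((n : ℝ) - lam (i + 1)) := by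
  have hb0 : (0 : ℝ) < b := by positivity
  refine (distInt_pow_mul_ofDigits_le hb (e := lam (i + 1) - 1) (by omega)
    fun j hj1 hj2 => h.digit_zero i j (by omega) (by omega)).trans (le_of_eq ?_)
  rw [Nat.cast_sub (by omega), Nat.cast_one]
  have e : (n : ℝ) - (lam (i + 1) - 1) = 1 + (n - lam (i + 1)) := by ring
  rw [e, Real.rpow_add hb0, Real.rpow_one]

theorem exists_gap (h : IsLacunary η C lam θ) (g : ℕ) :
    ∃ n₀, ∀ i, n₀ ≤ lam i → lam i + g ≤ lam (i + 1) := by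
  have hη := sub_pos.2 h.one_lt
  obtain ⟨n₀, hn₀⟩ := exists_nat_ge ((g + C) / (η - 1))
  refine ⟨n₀, fun i hi => ?_⟩
  rw [div_le_iff₀ hη] at hn₀
  have h1 := h.mul_le i
  have h2 : (n₀ : ℝ) ≤ lam i := by exact_mod_cast hi
  have h3 : (lam i : ℝ) + g ≤ lam (i + 1) := by nlinarith
  exact_mod_cast h3

theorem le_distInt (h : IsLacunary η C lam θ) (hb : 2 ≤ b) {i : ℕ}
    (hg : lam (i + 1) + 3 ≤ lam (i + 1 + 1)) :
    1 / (b : ℝ) ^ 2 ≤ distInt ((b : ℝ) ^ (lam (i + 1) - 1) * Real.ofDigits θ) := by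
  have hpos : 0 < lam (i + 1) := by
    have := h.strictMono (Nat.succ_pos i)
    rw [h.zero] at this
    exact this
  refine le_distInt_pow_mul_of_one_zero_zero hb (h.digit_one i) ?_ ?_
  · exact h.digit_zero (i + 1) _ (by omega) (by omega)
  · exact h.digit_zero (i + 1) _ (by omega) (by omega)

/-- From a position `n ≥ lam i`, the digit 1 at `lam (i + 1) - 1 ≤ ηn + C` ends the run of zeros,
and for large `i` it is itself followed by zeros. -/
theorem mul_inv_le_one (h : IsLacunary η C lam θ) (hb : 2 ≤ b) :
    ∀ a ∈ approxSet b (Real.ofDigits θ), a * η⁻¹ ≤ 1 := by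
  have hη : 0 < η := zero_lt_one.trans h.one_lt
  obtain ⟨n₀, hn₀⟩ := h.exists_gap 3
  have hb0 : (0 : ℝ) < b := by positivity
  intro a ha
  refine mul_le_one_of_mem_approxSet hb (C := η⁻¹ * C) (c := 1 / (b : ℝ) ^ 2) (n₀ := n₀)
    (by positivity) (fun n hn => ?_) ha
  obtain ⟨i, h1, h2⟩ := h.exists_le_lt n
  refine ⟨lam (i + 1) - 1, by omega, ?_, h.le_distInt hb (hn₀ _ (by omega))⟩
  have h3 : ((lam (i + 1) - 1 : ℕ) : ℝ) ≤ η * n + C := by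
    have e1 : ((lam (i + 1) - 1 : ℕ) : ℝ) ≤ lam (i + 1) := by exact_mod_cast Nat.sub_le _ _
    have e2 : (lam i : ℝ) ≤ n := by exact_mod_cast h1
    have := h.le_mul i
    nlinarith
  calc η⁻¹ * ((lam (i + 1) - 1 : ℕ) : ℝ) ≤ η⁻¹ * (η * n + C) := by gcongr
    _ = n + η⁻¹ * C := by field_simp

theorem mem_approxSet (h : IsLacunary η C lam θ) (hb : 2 ≤ b) {a : ℝ} (ha : 1 ≤ a)
    (haη : a * η⁻¹ < 1) : a ∈ approxSet b (Real.ofDigits θ) := by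
  have hη : 0 < η := zero_lt_one.trans h.one_lt
  have hb1 : (1 : ℝ) ≤ b := by exact_mod_cast (by omega : 1 ≤ b)
  have hb0 : (0 : ℝ) < b := by positivity
  refine mem_approxSet_of_frequently hb (a' := η) (C := b * (b : ℝ) ^ C) ha
    (by rwa [← div_eq_mul_inv, div_lt_one hη] at haη) fun N => ⟨lam N, h.strictMono.le_apply, ?_⟩
  refine (h.distInt_le hb le_rfl (h.strictMono N.lt_succ_self)).trans ?_
  rw [mul_assoc, ← Real.rpow_add hb0]
  have := h.mul_le N
  gcongr
  linarith

theorem approxExponent_eq (h : IsLacunary η C lam θ) (hb : 2 ≤ b) :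
    approxExponent b (Real.ofDigits θ) = (η : EReal) := by
  have hη : 0 < η := zero_lt_one.trans h.one_lt
  have := approxExponent_eq_of (inv_pos.2 hη) (inv_le_one_of_one_le₀ h.one_lt.le)
    (h.mul_inv_le_one hb) fun a => h.mem_approxSet hb
  rwa [inv_inv] at this

/-- Put `a = β⁻¹` with `β` above both terms of the maximum. Then `a² ` is a rate for `x`, and `a ≤
η`. Half of the exponent `a²` (multiplicatively) may be spent on reaching the next one of `y`; the
other half still yields the rate `a` for `x - y`. -/
theorem invExponent_sub_le (h : IsLacunary η C lam θ) (hb : 2 ≤ b) (x : ℝ) :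
    invExponent b (x - Real.ofDigits θ) ≤ max (√(invExponent b x)) η⁻¹ := by
  by_contra! hlt
  set y := Real.ofDigits θ
  have hη : 0 < η := zero_lt_one.trans h.one_lt
  have hb1 : (1 : ℝ) ≤ b := by exact_mod_cast (by omega : 1 ≤ b)
  have hb0 : (0 : ℝ) < b := by positivity
  obtain ⟨β, hβ, hβv⟩ := exists_between hlt
  -- The gap between `β` and `γ` absorbs the multiplicative constants.
  obtain ⟨γ, hγ, hγv⟩ := exists_between hβv
  have hβ0 : 0 < β := (inv_pos.2 hη).trans ((le_max_right _ _).trans_lt hβ)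
  have hγ0 : 0 < γ := hβ0.trans hγ
  have hv1 := invExponent_le_one b (x - y)
  set a := β⁻¹ with ha
  have ha1 : 1 ≤ a := (one_le_inv₀ hβ0).2 (hβv.le.trans hv1)
  have haη : a ≤ η := by
    rw [ha, inv_le_comm₀ hβ0 hη]; exact ((le_max_right _ _).trans_lt hβ).le
  have hx : a ^ 2 ∈ approxSet b x := by
    have h1 : invExponent b x < β ^ 2 := by
      rw [← Real.sqrt_lt' hβ0]; exact (le_max_left _ _).trans_lt hβ
    obtain ⟨A, hA, hA'⟩ := exists_mem_approxSet_of_invExponent_lt h1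
    refine mem_approxSet_of_le hb (one_le_pow₀ ha1) ?_ hA
    have hA0 : 0 < A := by linarith [hA.1]
    rw [ha, inv_pow]
    exact ((inv_lt_comm₀ hA0 (by positivity)).1 hA').le
  have hmem : γ⁻¹ ∈ approxSet b (x - y) := by
    refine mem_approxSet_of_frequently hb (a' := a) (C := 1 + b + b * (b : ℝ) ^ C)
      ((one_le_inv₀ hγ0).2 (hγv.le.trans hv1)) ((inv_lt_inv₀ hγ0 hβ0).2 hγ) fun N => ?_
    obtain ⟨n, hn, hnN⟩ := hx.2.exists_gt N
    have hn : distInt ((b : ℝ) ^ n * x) ≤ 1 / (b : ℝ) ^ ((n : ℝ) * (a ^ 2 - 1)) := hn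
    rw [one_div, ← Real.rpow_neg hb0.le] at hn
    have hn0 : (0 : ℝ) ≤ n := by positivity
    have key : ∀ m : ℕ, distInt ((b : ℝ) ^ m * x) ≤ (b : ℝ) ^ (-((m : ℝ) * (a - 1))) →
        distInt ((b : ℝ) ^ m * y) ≤ (b + b * (b : ℝ) ^ C) * (b : ℝ) ^ (-((m : ℝ) * (a - 1))) →
        distInt ((b : ℝ) ^ m * (x - y)) ≤
          (1 + b + b * (b : ℝ) ^ C) * (b : ℝ) ^ (-((m : ℝ) * (a - 1))) := by
      intro m h1 h2
      rw [mul_sub]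
      refine (distInt_sub_le _ _).trans ((add_le_add h1 h2).trans (le_of_eq ?_))
      ring
    obtain ⟨i, hi1, hi2⟩ := h.exists_le_lt n
    -- Either `y` has zeros from `n` to about `a n`, and the position `n` serves. Or `m = lam (i +
    -- 1) < a n`: then `x` is still well approximated at `m`, because `a² n > a m`, and `y` has
    -- zeros from `m` to about `η m ≥ a m`.
    rcases le_or_gt (a * n) (lam (i + 1)) with hcase | hcase
    · refine ⟨n, hnN.le, key n (hn.trans ?_) ((h.distInt_le hb hi1 hi2).trans ?_)⟩
      · apply Real.rpow_le_rpow_of_exponent_le hb1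
        nlinarith [mul_nonneg hn0 (mul_nonneg (zero_le_one.trans ha1) (sub_nonneg.2 ha1))]
      · have h1 : (b : ℝ) ^ ((n : ℝ) - lam (i + 1)) ≤ (b : ℝ) ^ (-((n : ℝ) * (a - 1))) := by
          apply Real.rpow_le_rpow_of_exponent_le hb1
          linarith
        have h2 : 0 ≤ b * (b : ℝ) ^ C := by positivity
        gcongr
        linarith
    · have hi0 : (0 : ℝ) ≤ lam (i + 1) := by positivity
      refine ⟨lam (i + 1), by omega, key _ ?_ ?_⟩
      · refine (distInt_pow_mul_le b hi2.le x).trans ?_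
        calc (b : ℝ) ^ (lam (i + 1) - n) * distInt ((b : ℝ) ^ n * x)
            ≤ (b : ℝ) ^ ((lam (i + 1) : ℝ) - n) * (b : ℝ) ^ (-((n : ℝ) * (a ^ 2 - 1))) := by
              rw [← Nat.cast_sub hi2.le, Real.rpow_natCast]
              gcongr
          _ = (b : ℝ) ^ ((lam (i + 1) : ℝ) - n + -((n : ℝ) * (a ^ 2 - 1))) :=
              (Real.rpow_add hb0 _ _).symm
          _ ≤ _ := by
              apply Real.rpow_le_rpow_of_exponent_le hb1
              nlinarith
      · refine (h.distInt_le hb le_rfl (h.strictMono (Nat.lt_succ_self _))).trans ?_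
        have h1 : (b : ℝ) ^ ((lam (i + 1) : ℝ) - lam (i + 1 + 1)) ≤
            (b : ℝ) ^ C * (b : ℝ) ^ (-((lam (i + 1) : ℝ) * (a - 1))) := by
          rw [← Real.rpow_add hb0]
          apply Real.rpow_le_rpow_of_exponent_le hb1
          have := h.mul_le (i + 1)
          nlinarith
        calc (b : ℝ) * (b : ℝ) ^ ((lam (i + 1) : ℝ) - lam (i + 1 + 1))
            ≤ b * ((b : ℝ) ^ C * (b : ℝ) ^ (-((lam (i + 1) : ℝ) * (a - 1)))) := by gcongr
          _ = (0 + b * (b : ℝ) ^ C) * (b : ℝ) ^ (-((lam (i + 1) : ℝ) * (a - 1))) := by ring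
          _ ≤ _ := by gcongr
  have := invExponent_le_inv hmem
  rw [inv_inv] at this
  linarith

theorem invExponent_le (h : IsLacunary η C lam θ) (hb : 2 ≤ b) (x : ℝ) :
    invExponent b x ≤ max (√(invExponent b (x - Real.ofDigits θ))) η⁻¹ := by
  have := h.invExponent_sub_le hb (Real.ofDigits θ - x)
  rw [sub_sub_cancel_left, invExponent_neg, ← neg_sub x, invExponent_neg] at this
  exact this

end IsLacunary

/-! ### Systems of runs -/

/-- Sparse intervals of blocks `[S k, T k)`. The lengths of the intervals with even (odd) index have
the limiting ratio `T k / S k → 1 / u` (respectively `1 / v`), and in terms of positions (a block has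
`K` of them) each interval starts at a prescribed place relative to the indices `lam i`. -/
structure IsRunSystem (η u v : ℝ) (lam : ℕ → ℕ) (K M : ℕ) (S T : ℕ → ℕ) : Prop where
  one_le : 1 ≤ S 0
  le : ∀ k, S k ≤ T k
  mul_le : ∀ k, M * T k ≤ S (k + 1)
  even_le : ∀ k, Even k → u * T k ≤ S k
  odd_le : ∀ k, ¬ Even k → v * T k ≤ S k
  even_ge : ∀ a, a * u < 1 → ∀ᶠ k in atTop, Even k → a * S k ≤ T k + 1
  odd_ge : ∀ a, a * v < 1 → ∀ᶠ k in atTop, ¬ Even k → a * S k ≤ T k + 1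
  start : ∀ k, ∃ i, max 1 (η * v) * lam i ≤ K * S k ∧ (K : ℝ) * S k ≤ max 1 (η * v) * lam i + K

/-- The admissible starts `s i` are the values `max 1 (η * v) * lam i` rounded up to whole blocks.
They are unbounded, so runs can be chosen recursively, as sparse as desired. -/
theorem exists_isRunSystem {η u v : ℝ} (hu : 0 ≤ u) (hu1 : u ≤ 1) (hv : 0 ≤ v) (hv1 : v ≤ 1)
    {lam : ℕ → ℕ} (hlam : StrictMono lam) {K : ℕ} (hK : 0 < K) (M : ℕ) :
    ∃ S T, IsRunSystem η u v lam K M S T := by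
  set t : ℝ := max 1 (η * v) with ht
  have ht1 : 1 ≤ t := le_max_left _ _
  have hK0 : (0 : ℝ) < K := by exact_mod_cast hK
  let s : ℕ → ℕ := fun i => ⌈t * lam i / K⌉₊
  have hs1 : ∀ i, t * lam i ≤ K * s i := fun i => by
    have := Nat.le_ceil (t * lam i / K)
    rwa [div_le_iff₀' hK0] at this
  have hs2 : ∀ i, (K : ℝ) * s i ≤ t * lam i + K := fun i => by
    have := (Nat.ceil_lt_add_one (a := t * lam i / K) (by positivity)).le
    rw [← sub_le_iff_le_add, le_div_iff₀' hK0, mul_sub, mul_one] at this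
    linarith
  have hunb : ∀ c : ℕ, ∃ i, c ≤ s i := by
    intro c
    refine ⟨K * c, ?_⟩
    have h1 : ((K * c : ℕ) : ℝ) ≤ lam (K * c) := by exact_mod_cast hlam.le_apply
    have h2 := hs1 (K * c)
    push_cast at h1
    have h3 : (lam (K * c) : ℝ) ≤ t * lam (K * c) := le_mul_of_one_le_left (by positivity) ht1
    have h4 : (K : ℝ) * c ≤ K * s (K * c) := by linarith
    exact_mod_cast le_of_mul_le_mul_left h4 hK0
  choose f hf using hunb
  -- The floor `1/(k + 1)` keeps the runs finite when `u` or `v` is 0, and it disappears in the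
  -- limit.
  let κ : ℕ → ℝ := fun k => max (if Even k then u else v) (1 / ((k : ℝ) + 1))
  have hκ0 : ∀ k, 0 < κ k := fun k => lt_of_lt_of_le (by positivity) (le_max_right _ _)
  have hκ1 : ∀ k, κ k ≤ 1 := fun k => by
    refine max_le (by split_ifs <;> assumption) ?_
    rw [div_le_one (by positivity)]
    have : (0 : ℝ) ≤ k := by positivity
    linarith
  let τ : ℕ → ℕ → ℕ := fun k i => ⌊(s i : ℝ) / κ k⌋₊
  let j : ℕ → ℕ := fun k => Nat.rec (f 1) (fun k i => f (M * τ k i)) k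
  have hT : ∀ k, κ k * τ k (j k) ≤ s (j k) := fun k => by
    have : (τ k (j k) : ℝ) ≤ s (j k) / κ k := Nat.floor_le (by have := hκ0 k; positivity)
    rwa [le_div_iff₀' (hκ0 k)] at this
  have hge : ∀ w : ℝ, 0 ≤ w → ∀ a, a * w < 1 →
      ∀ᶠ k : ℕ in atTop, max w (1 / ((k : ℝ) + 1)) = κ k → a * s (j k) ≤ τ k (j k) + 1 := by
    intro w hw a ha
    have hlim : Tendsto (fun k : ℕ => a * max w (1 / ((k : ℝ) + 1))) atTop (𝓝 (a * max w 0)) :=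
      (tendsto_const_nhds.max tendsto_one_div_add_atTop_nhds_zero_nat).const_mul a
    rw [max_eq_left hw] at hlim
    filter_upwards [hlim.eventually_lt_const ha] with k hk hkκ
    rw [hkκ] at hk
    have h1 : (s (j k) : ℝ) / κ k < τ k (j k) + 1 := Nat.lt_floor_add_one _
    refine le_trans ?_ h1.le
    rw [le_div_iff₀ (hκ0 k)]
    have : (0 : ℝ) ≤ s (j k) := by positivity
    nlinarith
  refine ⟨fun k => s (j k), fun k => τ k (j k), hf 1, fun k => ?_, fun k => hf _, fun k hk => ?_,
    fun k hk => ?_, fun a ha => ?_, fun a ha => ?_, fun k => ⟨j k, hs1 _, hs2 _⟩⟩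
  · apply Nat.le_floor
    rw [le_div_iff₀ (hκ0 k)]
    exact mul_le_of_le_one_right (by positivity) (hκ1 k)
  · refine le_trans ?_ (hT k)
    gcongr
    simp [κ, hk]
  · refine le_trans ?_ (hT k)
    gcongr
    simp [κ, hk]
  · filter_upwards [hge u hu a ha] with k h hk
    exact h (by simp [κ, hk])
  · filter_upwards [hge v hv a ha] with k h hk
    exact h (by simp [κ, hk])

/-- The block `j` lies in one of the runs. -/
def InRun (S T : ℕ → ℕ) (j : ℕ) : Prop := ∃ k, S k ≤ j ∧ j < T k

namespace IsRunSystem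

variable {η u v : ℝ} {lam : ℕ → ℕ} {K M : ℕ} {S T : ℕ → ℕ}

theorem le_succ (h : IsRunSystem η u v lam K M S T) (hM : 3 ≤ M) (k : ℕ) :
    3 * T k ≤ S (k + 1) :=
  (Nat.mul_le_mul_right _ hM).trans (h.mul_le k)

theorem monotone (h : IsRunSystem η u v lam K M S T) (hM : 3 ≤ M) : Monotone S :=
  monotone_nat_of_le_succ fun k => by
    have := h.le k
    have := h.le_succ hM k
    omega

theorem lt_start (h : IsRunSystem η u v lam K M S T) (hM : 3 ≤ M) (k : ℕ) : k < S k := by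
  induction k with
  | zero => exact h.one_le
  | succ k ih =>
    have := h.le k
    have := h.le_succ hM k
    omega

theorem stop_le_start (h : IsRunSystem η u v lam K M S T) (hM : 3 ≤ M) {k k' : ℕ} (hk : k < k') :
    3 * T k ≤ S k' :=
  (h.le_succ hM k).trans (h.monotone hM hk)

theorem eq_of_mem (h : IsRunSystem η u v lam K M S T) (hM : 3 ≤ M) {k k' j : ℕ}
    (h1 : S k ≤ j) (h2 : j < T k) (h3 : S k' ≤ j) (h4 : j < T k') : k = k' := by
  rcases lt_trichotomy k k' with hk | hk | hk
  · have := h.stop_le_start hM hk; omega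
  · exact hk
  · have := h.stop_le_start hM hk; omega

theorem not_inRun_of_lt_start (h : IsRunSystem η u v lam K M S T) (hM : 3 ≤ M) {j : ℕ}
    (hj : j < S 0) : ¬ InRun S T j := by
  rintro ⟨k, h1, -⟩
  have := h.monotone hM (Nat.zero_le k)
  omega

theorem not_inRun_of_between (h : IsRunSystem η u v lam K M S T) (hM : 3 ≤ M) {k j : ℕ}
    (h1 : T k ≤ j) (h2 : j < S (k + 1)) : ¬ InRun S T j := by
  rintro ⟨k', h3, h4⟩
  rcases lt_or_ge k k' with hk | hk
  · have := h.monotone hM (show k + 1 ≤ k' from hk); omega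
  · rcases hk.eq_or_lt with rfl | hk
    · omega
    · have := h.stop_le_start hM hk
      have := h.le k
      omega

theorem not_inRun_stop (h : IsRunSystem η u v lam K M S T) (hM : 3 ≤ M) (k : ℕ) :
    ¬ InRun S T (T k) ∧ ¬ InRun S T (T k + 1) := by
  have h1 := h.le_succ hM k
  have h2 := h.le k
  have h3 := h.lt_start hM k
  exact ⟨h.not_inRun_of_between hM le_rfl (by omega),
    h.not_inRun_of_between hM (Nat.le_succ _) (by omega)⟩

theorem exists_between (h : IsRunSystem η u v lam K M S T) (hM : 3 ≤ M) {j : ℕ}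
    (hj : ¬ InRun S T j) : j < S 0 ∨ ∃ k, T k ≤ j ∧ j < S (k + 1) := by
  classical
  by_cases h0 : j < S 0
  · exact Or.inl h0
  right
  have hex : ∃ k, j < S (k + 1) := ⟨j, (Nat.lt_succ_self j).trans (h.lt_start hM (j + 1))⟩
  refine ⟨Nat.find hex, ?_, Nat.find_spec hex⟩
  have hS : S (Nat.find hex) ≤ j := by
    rcases hi : Nat.find hex with _ | i
    · exact not_lt.1 h0
    · exact not_lt.1 (Nat.find_min hex (m := i) (by omega))
  by_contra! hlt
  exact hj ⟨_, hS, hlt⟩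

end IsRunSystem

/-- The digits `d` vanish in the even runs, agree with `θ` in the odd runs, and the blocks outside
the runs end with the digits `0, 1`. -/
structure IsRunExpansion {b : ℕ} (K : ℕ) (S T : ℕ → ℕ) (θ d : ℕ → Fin b) : Prop where
  even : ∀ k, Even k → ∀ n, K * S k ≤ n → n < K * T k → (d n : ℕ) = 0
  odd : ∀ k, ¬ Even k → ∀ n, K * S k ≤ n → n < K * T k → d n = θ n
  free_zero : ∀ j, ¬ InRun S T j → (d (K * j + (K - 2)) : ℕ) = 0
  free_one : ∀ j, ¬ InRun S T j → (d (K * j + (K - 2) + 1) : ℕ) = 1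

namespace IsRunExpansion

variable {b : ℕ} {η C u v : ℝ} {lam : ℕ → ℕ} {K M : ℕ} {S T : ℕ → ℕ} {θ d : ℕ → Fin b}

theorem le_distInt (h : IsRunExpansion K S T θ d) (hb : 2 ≤ b) {j : ℕ} (hj : ¬ InRun S T j) :
    1 / (b : ℝ) ^ 2 ≤ distInt ((b : ℝ) ^ (K * j + (K - 2)) * Real.ofDigits d) :=
  le_distInt_pow_mul_of_zero_one hb (h.free_zero j hj) (h.free_one j hj)

/-- A run makes the distance at `K * S k` at most `b^(-K (T k - S k))`. The rounding `+ 1` in the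
length of a run costs only the factor `b^K`. -/
theorem mem_approxSet_of_runs (hS : IsRunSystem η u v lam K M S T) (hK : 0 < K)
    (hM : 3 ≤ M) (hb : 2 ≤ b) {a w x : ℝ} (ha : 1 ≤ a) (haw : a * w < 1) {p : ℕ → Prop}
    (hp : ∀ N, ∃ k, N ≤ k ∧ p k)
    (hge : ∀ a, a * w < 1 → ∀ᶠ k in atTop, p k → a * S k ≤ T k + 1)
    (hx : ∀ k, p k → distInt ((b : ℝ) ^ (K * S k) * x) ≤
      (b : ℝ) ^ (((K * S k : ℕ) : ℝ) - (K * T k : ℕ))) : a ∈ approxSet b x := by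
  have hb1 : (1 : ℝ) ≤ b := by exact_mod_cast (by omega : 1 ≤ b)
  have hb0 : (0 : ℝ) < b := by positivity
  obtain ⟨a', haa, haw'⟩ : ∃ a', a < a' ∧ a' * w < 1 := by
    have hc : Tendsto (fun a : ℝ => a * w) (𝓝[>] a) (𝓝 (a * w)) :=
      ((continuous_id.mul continuous_const).tendsto a).mono_left nhdsWithin_le_nhds
    obtain ⟨a', h1, h2⟩ := ((hc.eventually_lt_const haw).and self_mem_nhdsWithin).exists
    exact ⟨a', h2, h1⟩
  obtain ⟨N₀, hN₀⟩ := eventually_atTop.1 (hge a' haw')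
  refine mem_approxSet_of_frequently hb (a' := a') (C := (b : ℝ) ^ (K : ℝ)) ha haa fun N => ?_
  obtain ⟨k, hk, hpk⟩ := hp (max N N₀)
  have h1 := hN₀ k (by omega) hpk
  refine ⟨K * S k, ?_, (hx k hpk).trans ?_⟩
  · have := hS.lt_start hM k
    have := Nat.le_mul_of_pos_left (S k) hK
    omega
  · rw [← Real.rpow_add hb0]
    apply Real.rpow_le_rpow_of_exponent_le hb1
    push_cast
    have hK0 : (0 : ℝ) ≤ K := by positivity
    nlinarith [mul_le_mul_of_nonneg_left h1 hK0]

/-- Every free block contains `0, 1`, so good approximations occur only inside runs, whose ratio is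
at most `1/u` because `u ≤ v`. In particular the zeros of `y` copied in odd runs do no harm. -/
theorem invExponent_eq (h : IsRunExpansion K S T θ d) (hS : IsRunSystem η u v lam K M S T)
    (hK : 3 ≤ K) (hM : 3 ≤ M) (hb : 2 ≤ b) (hu : 0 ≤ u) (huv : u ≤ v) (hv1 : v ≤ 1) :
    invExponent b (Real.ofDigits d) = u := by
  have hb0 : (0 : ℝ) < b := by positivity
  refine invExponent_eq_of hu ?_ fun a ha haw => ?_
  · intro a ha
    refine mul_le_one_of_mem_approxSet hb (u := u) (C := 3 * K) (c := 1 / (b : ℝ) ^ 2) (n₀ := 0)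
      (by positivity) (fun n _ => ?_) ha
    have hdiv := Nat.div_add_mod n K
    have hmod := Nat.mod_lt n (show 0 < K by omega)
    set q := n / K
    -- The digits `0, 1` of block `q` may lie before `n`, so the next block is tested instead.
    by_cases hj : InRun S T (q + 1)
    · obtain ⟨k, h1, h2⟩ := hj
      have h3 := Nat.mul_le_mul_left K h1
      have h4 := Nat.mul_le_mul_left K h2.le
      rw [Nat.mul_add, Nat.mul_one] at h3 h4
      refine ⟨K * T k + (K - 2), by omega, ?_, h.le_distInt hb (hS.not_inRun_stop hM k).1⟩
      have h5 : u * T k ≤ S k := by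
        by_cases hk : Even k
        · exact hS.even_le k hk
        · exact (mul_le_mul_of_nonneg_right huv (by positivity)).trans (hS.odd_le k hk)
      have h6 : ((K * S k : ℕ) : ℝ) ≤ ((n + K : ℕ) : ℝ) := by exact_mod_cast (by omega)
      have h7 : ((K - 2 : ℕ) : ℝ) ≤ K := by exact_mod_cast Nat.sub_le _ _
      push_cast at h6 ⊢
      have hK0 : (0 : ℝ) ≤ K := by positivity
      nlinarith [mul_le_mul_of_nonneg_left h5 hK0, mul_le_mul_of_nonneg_left h7 hu]
    · refine ⟨K * (q + 1) + (K - 2), by rw [Nat.mul_add]; omega, ?_, h.le_distInt hb hj⟩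
      have h6 : ((K * (q + 1) + (K - 2) : ℕ) : ℝ) ≤ ((n + 2 * K : ℕ) : ℝ) := by
        exact_mod_cast (by rw [Nat.mul_add]; omega)
      refine (mul_le_of_le_one_left (by positivity) (huv.trans hv1)).trans (h6.trans ?_)
      push_cast
      have hK0 : (0 : ℝ) ≤ K := by positivity
      linarith
  · refine mem_approxSet_of_runs hS (by omega) hM hb ha haw (p := fun k => Even k)
      (fun N => ⟨2 * N, by omega, even_two_mul N⟩) hS.even_ge fun k hk => ?_
    exact distInt_pow_mul_ofDigits_le hb (Nat.mul_le_mul_left K (hS.le k)) (h.even k hk)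

/-- Ones of `y` are more than two blocks apart. Hence in one of two consecutive free blocks the
digits `0, 1` of `x` fall where `y` has enough zeros, and `y` contributes at most half of the
distance. -/
theorem exists_le_distInt_sub (h : IsRunExpansion K S T θ d) (hθ : IsLacunary η C lam θ)
    (hK : 3 ≤ K) (hb : 2 ≤ b) {n₁ : ℕ} (hgap : ∀ i, n₁ ≤ lam i → lam i + 3 * K ≤ lam (i + 1))
    {j : ℕ} (hj₁ : n₁ ≤ K * j) (hj : ¬ InRun S T j) (hj' : ¬ InRun S T (j + 1)) :
    ∃ m, K * j ≤ m ∧ m ≤ K * j + 2 * K ∧ 1 / (2 * (b : ℝ) ^ 2) ≤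
      distInt ((b : ℝ) ^ m * (Real.ofDigits d - Real.ofDigits θ)) := by
  have hb2 : (2 : ℝ) ≤ b := by exact_mod_cast hb
  have hb0 : (0 : ℝ) < b := by positivity
  have key : ∀ m i, lam i ≤ m → m + 4 ≤ lam (i + 1) →
      1 / (b : ℝ) ^ 2 ≤ distInt ((b : ℝ) ^ m * Real.ofDigits d) → 1 / (2 * (b : ℝ) ^ 2) ≤
      distInt ((b : ℝ) ^ m * (Real.ofDigits d - Real.ofDigits θ)) := by
    intro m i h1 h2 h3
    have h4 := hθ.distInt_le hb h1 (by omega)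
    have h5 : (b : ℝ) * (b : ℝ) ^ ((m : ℝ) - lam (i + 1)) ≤ 1 / (2 * (b : ℝ) ^ 2) := by
      have e1 : ((m + 4 : ℕ) : ℝ) ≤ lam (i + 1) := by exact_mod_cast h2
      push_cast at e1
      calc (b : ℝ) * (b : ℝ) ^ ((m : ℝ) - lam (i + 1)) ≤ b * (b : ℝ) ^ (-(4 : ℝ)) := by
            gcongr <;> linarith
        _ = 1 / (b * (b : ℝ) ^ 2) := by
            rw [Real.rpow_neg hb0.le, show (4 : ℝ) = (4 : ℕ) by norm_num, Real.rpow_natCast]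
            field_simp
        _ ≤ _ := by gcongr
    have h6 := distInt_le_add_sub ((b : ℝ) ^ m * Real.ofDigits d) ((b : ℝ) ^ m * Real.ofDigits θ)
    rw [← mul_sub] at h6
    have h7 : 1 / (b : ℝ) ^ 2 = 1 / (2 * (b : ℝ) ^ 2) + 1 / (2 * (b : ℝ) ^ 2) := by
      field_simp; norm_num
    linarith
  obtain ⟨i, h1, h2⟩ := hθ.exists_le_lt (K * j + (K - 2))
  by_cases hlt : K * j + (K - 2) + 4 ≤ lam (i + 1)
  · exact ⟨_, by omega, by omega, key _ i h1 hlt (h.le_distInt hb hj)⟩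
  · have hg := hgap (i + 1) (by omega)
    refine ⟨K * (j + 1) + (K - 2), by rw [Nat.mul_add]; omega, by rw [Nat.mul_add]; omega,
      key _ (i + 1) ?_ ?_ (h.le_distInt hb hj')⟩
    · rw [Nat.mul_add]; omega
    · rw [Nat.mul_add]; omega

/-- Within an even run, either the expansion `θ` has a digit `1` not much further than allowed by the
exponent `v`, or the run ends there. -/
theorem even_run_bound (hθ : IsLacunary η C lam θ) (hS : IsRunSystem η u v lam K M S T)
    (hv1 : v ≤ 1) (hv : v ≤ η⁻¹ ∨ v ^ 2 ≤ u) {k n i : ℕ}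
    (hk : Even k) (hn : K * S k ≤ n) (hi : lam i ≤ n) (hi' : n < lam (i + 1)) :
    v * lam (i + 1) ≤ n + (C + K * η) ∨ v * (K * T k) ≤ n + (C + K * η) := by
  have hη : 0 < η := zero_lt_one.trans hθ.one_lt
  have hC := hθ.nonneg
  have hK0 : (0 : ℝ) ≤ K := by positivity
  have hKη : 0 ≤ K * η := by positivity
  have hnR : (lam i : ℝ) ≤ n := by exact_mod_cast hi
  have hle := hθ.le_mul i
  have hli : (0 : ℝ) ≤ lam i := by positivity
  rcases le_or_gt v η⁻¹ with hvη | hvη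
  · left
    have h1 : v * η ≤ 1 := by rwa [← le_div_iff₀ hη, one_div]
    rcases le_or_gt 0 v with h0 | h0
    · nlinarith [mul_le_mul_of_nonneg_left hle h0, mul_le_mul_of_nonneg_right h1 hli]
    · have : v * lam (i + 1) ≤ 0 := mul_nonpos_of_nonpos_of_nonneg h0.le (by positivity)
      linarith
  · have hv0 : 0 < v := (inv_pos.2 hη).trans hvη
    have hvu : v ^ 2 ≤ u := hv.resolve_left (not_le.2 hvη)
    have hvη1 : 1 < η * v := by rwa [inv_lt_iff_one_lt_mul₀' hη] at hvη
    -- The run starts near `η v lam i₀`, hence `lam (i₀ + 1) ≈ η lam i₀` is about `1/v` times its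
    -- start. Before that one of `y`, it is the obstruction. After it, the end of the run is, since
    -- `v² T ≤ u T ≤ S`.
    obtain ⟨i₀, h1, h2⟩ := hS.start k
    rw [max_eq_right hvη1.le] at h1 h2
    have hnS : (K : ℝ) * S k ≤ n := by exact_mod_cast hn
    have hi₀ : i₀ ≤ i := by
      have h3 : (lam i₀ : ℝ) < lam (i + 1) := by
        have e1 : (n : ℝ) < lam (i + 1) := by exact_mod_cast hi'
        have e2 : (lam i₀ : ℝ) ≤ η * v * lam i₀ := le_mul_of_one_le_left (by positivity) hvη1.le
        linarith
      have h4 := hθ.strictMono.lt_iff_lt.1 (by exact_mod_cast h3 : lam i₀ < lam (i + 1))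
      omega
    rcases hi₀.eq_or_lt with rfl | hlt
    · left
      nlinarith [mul_le_mul_of_nonneg_left hle hv0.le]
    · right
      have h3 : (lam (i₀ + 1) : ℝ) ≤ n :=
        le_trans (by exact_mod_cast hθ.strictMono.monotone hlt) hnR
      have h4 := hθ.mul_le i₀
      have h5 := hS.even_le k hk
      have h6 : 1 ≤ v * η := by linarith
      have h7 : v * (v * (K * T k)) ≤ v * (n + (C + K * η)) := by
        have hKT : (0 : ℝ) ≤ K * T k := by positivity
        calc v * (v * (K * T k)) = v ^ 2 * (K * T k) := by ring
          _ ≤ u * (K * T k) := by gcongr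
          _ = K * (u * T k) := by ring
          _ ≤ K * S k := by gcongr
          _ ≤ η * v * lam i₀ + K := h2
          _ = v * (η * lam i₀) + K * 1 := by ring
          _ ≤ v * (n + C) + K * (v * η) := by gcongr; linarith
          _ = _ := by ring
      exact le_of_mul_le_mul_left h7 hv0

/-- Odd runs realise the rate `1/v`. Nothing better occurs: beyond any large `n`, within a factor
`1/v` up to bounded errors, there is a free pair of blocks, the end of a run, or a one of `y` facing
zeros of `x`. -/
theorem invExponent_sub_eq (h : IsRunExpansion K S T θ d) (hθ : IsLacunary η C lam θ)
    (hS : IsRunSystem η u v lam K M S T) (hK : 3 ≤ K) (hM : 3 ≤ M) (hb : 2 ≤ b)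
    (hv0 : 0 ≤ v) (hv1 : v ≤ 1) (hv : v ≤ η⁻¹ ∨ v ^ 2 ≤ u) :
    invExponent b (Real.ofDigits d - Real.ofDigits θ) = v := by
  have hb2 : (2 : ℝ) ≤ b := by exact_mod_cast hb
  have hb0 : (0 : ℝ) < b := by positivity
  have hK0 : (0 : ℝ) ≤ K := by positivity
  have hη : 0 < η := zero_lt_one.trans hθ.one_lt
  have hC := hθ.nonneg
  refine invExponent_eq_of hv0 ?_ fun a ha haw => ?_
  · intro a ha
    obtain ⟨n₁, hgap⟩ := hθ.exists_gap (3 * K)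
    set D := C + K * η with hD
    have hD0 : 0 ≤ D := by positivity
    refine mul_le_one_of_mem_approxSet hb (u := v) (C := D + 4 * K + 3)
      (c := 1 / (2 * (b : ℝ) ^ 2)) (n₀ := n₁) (by positivity) (fun n hn => ?_) ha
    have hdiv := Nat.div_add_mod n K
    have hmod := Nat.mod_lt n (show 0 < K by omega)
    set q := n / K
    have hq1 : K * (q + 1) = K * q + K := by ring
    have hq2 : K * (q + 1 + 1) = K * q + 2 * K := by ring
    by_cases hfree : ¬ InRun S T (q + 1) ∧ ¬ InRun S T (q + 1 + 1)
    · obtain ⟨m, h1, h2, h3⟩ := h.exists_le_distInt_sub hθ hK hb hgap (j := q + 1) (by omega)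
        hfree.1 hfree.2
      refine ⟨m, by omega, ?_, h3⟩
      have h4 : (m : ℝ) ≤ ((n + 3 * K : ℕ) : ℝ) := by exact_mod_cast (by omega)
      refine (mul_le_of_le_one_left (by positivity) hv1).trans (h4.trans ?_)
      push_cast
      linarith
    · obtain ⟨k, hk1, hk2⟩ : ∃ k, S k ≤ q + 1 + 1 ∧ q + 1 < T k := by
        rw [not_and_or, not_not, not_not] at hfree
        rcases hfree with ⟨k, h1, h2⟩ | ⟨k, h1, h2⟩
        · exact ⟨k, by omega, h2⟩
        · exact ⟨k, h1, by omega⟩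
      have hs := Nat.mul_le_mul_left K hk1
      have he := Nat.mul_le_mul_left K hk2.le
      have hend : v * (K * T k) ≤ n + (D + 2 * K + 3) → ∃ m, n ≤ m ∧
          v * m ≤ n + (D + 4 * K + 3) ∧ 1 / (2 * (b : ℝ) ^ 2) ≤
          distInt ((b : ℝ) ^ m * (Real.ofDigits d - Real.ofDigits θ)) := by
        intro hle
        obtain ⟨h1, h2⟩ := hS.not_inRun_stop hM k
        obtain ⟨m, h3, h4, h5⟩ := h.exists_le_distInt_sub hθ hK hb hgap (j := T k) (by omega)
          h1 h2
        refine ⟨m, by omega, ?_, h5⟩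
        have h6 : (m : ℝ) ≤ ((K * T k + 2 * K : ℕ) : ℝ) := by exact_mod_cast h4
        push_cast at h6
        nlinarith [mul_le_mul_of_nonneg_left h6 hv0, mul_le_of_le_one_left hK0 hv1]
      have hsR : ((K * S k : ℕ) : ℝ) ≤ ((n + 2 * K : ℕ) : ℝ) := by exact_mod_cast (by omega)
      push_cast at hsR
      by_cases hk : Even k
      · set n' := max n (K * S k) with hn'
        have hn'R : (n' : ℝ) ≤ n + 2 * K := by
          have : n' ≤ n + 2 * K := by omega
          exact_mod_cast this
        have hSK := Nat.mul_le_mul_left K (hS.le k)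
        obtain ⟨i, hi1, hi2⟩ := hθ.exists_le_lt n'
        rcases even_run_bound hθ hS hv1 hv hk (le_max_right n _) hi1 hi2 with hvi | hvi
        · by_cases hrun : lam (i + 1) + 3 ≤ K * T k
          · refine ⟨lam (i + 1) - 1, by omega, ?_, ?_⟩
            · have : ((lam (i + 1) - 1 : ℕ) : ℝ) ≤ lam (i + 1) := by
                exact_mod_cast Nat.sub_le _ _
              nlinarith [mul_le_mul_of_nonneg_left this hv0]
            · have h1 := hθ.le_distInt hb (i := i) (by
                have := hgap (i + 1) (by omega); omega)
              have h2 := distInt_pow_mul_ofDigits_le hb (d := d) (n := lam (i + 1) - 1)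
                (e := K * T k) (by omega) fun n hn1 hn2 => h.even k hk n (by omega) hn2
              have h3 : (b : ℝ) ^ (((lam (i + 1) - 1 : ℕ) : ℝ) - (K * T k : ℕ))
                  ≤ 1 / (2 * (b : ℝ) ^ 2) := by
                have e1 : ((lam (i + 1) - 1 + 3 : ℕ) : ℝ) ≤ ((K * T k : ℕ) : ℝ) := by
                  exact_mod_cast (by omega)
                rw [Nat.cast_add] at e1
                calc (b : ℝ) ^ (((lam (i + 1) - 1 : ℕ) : ℝ) - (K * T k : ℕ))
                    ≤ (b : ℝ) ^ (-(3 : ℝ)) := by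
                      gcongr
                      · linarith
                      · push_cast at e1 ⊢; linarith
                  _ = 1 / (b * (b : ℝ) ^ 2) := by
                      rw [Real.rpow_neg hb0.le, show (3 : ℝ) = (3 : ℕ) by norm_num,
                        Real.rpow_natCast]
                      field_simp
                  _ ≤ _ := by gcongr
              have h4 := distInt_le_add_sub ((b : ℝ) ^ (lam (i + 1) - 1) * Real.ofDigits θ)
                ((b : ℝ) ^ (lam (i + 1) - 1) * Real.ofDigits d)
              rw [← mul_sub, ← distInt_neg (_ * (_ - _)), ← mul_neg, neg_sub] at h4
              have h5 : 1 / (b : ℝ) ^ 2 = 1 / (2 * (b : ℝ) ^ 2) + 1 / (2 * (b : ℝ) ^ 2) := by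
                field_simp; norm_num
              linarith
          · apply hend
            have h1 : ((K * T k : ℕ) : ℝ) ≤ ((lam (i + 1) + 3 : ℕ) : ℝ) := by
              exact_mod_cast (by omega)
            push_cast at h1
            nlinarith [mul_le_mul_of_nonneg_left h1 hv0]
        · apply hend
          linarith
      · apply hend
        have := mul_le_mul_of_nonneg_left (hS.odd_le k hk) hK0
        linarith
  · refine mem_approxSet_of_runs hS (by omega) hM hb ha haw (p := fun k => ¬ Even k)
      (fun N => ⟨2 * N + 1, by omega, by simp⟩) hS.odd_ge fun k hk => ?_
    exact distInt_pow_mul_sub_le hb (Nat.mul_le_mul_left K (hS.le k)) (h.odd k hk)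

end IsRunExpansion

/-! ### The lower bound for the dimension -/

/-- The hypothesis makes `Z` an `r`-Hölder function of `X`. Its image contains `[0, 1]`, and an
`r`-Hölder map multiplies dimension by at most `1/r`. -/
theorem le_dimH_range_of_holder {Ω : Type*} {X Z : Ω → ℝ} {C r : ℝ} (hC : 0 ≤ C) (hr : 0 < r)
    (h : ∀ ω ω', |Z ω - Z ω'| ≤ C * |X ω - X ω'| ^ r) (hZ : Icc 0 1 ⊆ range Z) :
    ENNReal.ofReal r ≤ dimH (range X) := by
  classical
  have : Nonempty Ω := let ⟨ω, _⟩ := hZ (left_mem_Icc.2 zero_le_one); ⟨ω⟩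
  lift C to NNReal using hC
  lift r to NNReal using hr.le
  have hr0 : 0 < r := by exact_mod_cast hr
  choose! g hg using fun x (hx : x ∈ range X) => hx
  have hH : HolderOnWith C r (Z ∘ g) (range X) := by
    intro x hx x' hx'
    have h1 := h (g x) (g x')
    rw [hg x hx, hg x' hx'] at h1
    rw [edist_dist, edist_dist, Real.dist_eq, Real.dist_eq,
      ENNReal.ofReal_rpow_of_nonneg (abs_nonneg _) r.coe_nonneg, ← ENNReal.ofReal_coe_nnreal,
      ← ENNReal.ofReal_mul C.coe_nonneg]
    exact ENNReal.ofReal_le_ofReal h1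
  have himg : Icc 0 1 ⊆ (Z ∘ g) '' range X := by
    intro z hz
    obtain ⟨ω, rfl⟩ := hZ hz
    refine ⟨X ω, ⟨ω, rfl⟩, ?_⟩
    have h1 := h (g (X ω)) ω
    rw [hg (X ω) ⟨ω, rfl⟩, sub_self, abs_zero, Real.zero_rpow hr.ne', mul_zero] at h1
    have := abs_nonpos_iff.1 h1
    simp only [Function.comp]
    linarith
  have hone : dimH (Icc (0 : ℝ) 1) = 1 := by
    rw [Real.dimH_of_nonempty_interior (by simp [interior_Icc])]
    simp
  have h2 := hone.ge.trans ((dimH_mono himg).trans (hH.dimH_image_le hr0))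
  rw [ENNReal.le_div_iff_mul_le (Or.inl (by exact_mod_cast hr0.ne')) (Or.inl ENNReal.coe_ne_top),
    one_mul] at h2
  rwa [ENNReal.ofReal_coe_nnreal]

theorem le_count_of_forall (p : ℕ → Prop) [DecidablePred p] {m n : ℕ} (hmn : m ≤ n)
    (h : ∀ i, m ≤ i → i < n → p i) : Nat.count p m + (n - m) ≤ Nat.count p n := by
  induction n, hmn using Nat.le_induction with
  | base => simp
  | succ n hmn ih =>
    rw [Nat.count_succ, if_pos (h n hmn n.lt_succ_self)]
    have := ih fun i h1 h2 => h i h1 (h2.trans n.lt_succ_self)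
    omega

/-- The position `n` carries a free digit. -/
def FreeAt (K : ℕ) (S T : ℕ → ℕ) (n : ℕ) : Prop := ¬ InRun S T (n / K) ∧ n % K + 2 < K

open Classical in
/-- The digits determined by a system of runs and by the free digits `ω`. -/
def runDigits {b : ℕ} (hb : 2 ≤ b) (K : ℕ) (S T : ℕ → ℕ) (θ ω : ℕ → Fin b) (n : ℕ) : Fin b :=
  if ∃ k, Even k ∧ S k ≤ n / K ∧ n / K < T k then ⟨0, by omega⟩
  else if InRun S T (n / K) then θ n
  else if n % K + 2 < K then ω (Nat.count (FreeAt K S T) n)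
  else if n % K + 2 = K then ⟨0, by omega⟩ else ⟨1, by omega⟩

section

variable {b : ℕ} {η u v : ℝ} {lam : ℕ → ℕ} {K M : ℕ} {S T : ℕ → ℕ}

open Classical in
theorem runDigits_of_not_inRun (hb : 2 ≤ b) (θ ω : ℕ → Fin b) {n : ℕ} (h : ¬ InRun S T (n / K)) :
    runDigits hb K S T θ ω n = if n % K + 2 < K then ω (Nat.count (FreeAt K S T) n)
      else if n % K + 2 = K then ⟨0, by omega⟩ else ⟨1, by omega⟩ := by
  rw [runDigits, if_neg, if_neg h]
  rintro ⟨k, -, hk⟩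
  exact h ⟨k, hk⟩

theorem isRunExpansion_runDigits (hS : IsRunSystem η u v lam K M S T) (hK : 3 ≤ K) (hM : 3 ≤ M)
    (hb : 2 ≤ b) (θ ω : ℕ → Fin b) : IsRunExpansion K S T θ (runDigits hb K S T θ ω) := by
  have hK0 : 0 < K := by omega
  have hmem : ∀ k n, K * S k ≤ n → n < K * T k → S k ≤ n / K ∧ n / K < T k := by
    intro k n h1 h2
    exact ⟨(Nat.le_div_iff_mul_le hK0).2 (by rwa [mul_comm]),
      (Nat.div_lt_iff_lt_mul hK0).2 (by rwa [mul_comm])⟩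
  refine ⟨fun k hk n h1 h2 => ?_, fun k hk n h1 h2 => ?_, fun j hj => ?_, fun j hj => ?_⟩
  · rw [runDigits, if_pos ⟨k, hk, hmem k n h1 h2⟩]
  · have hm := hmem k n h1 h2
    rw [runDigits, if_neg, if_pos ⟨k, hm⟩]
    rintro ⟨k', hk', h3, h4⟩
    exact hk (hS.eq_of_mem hM hm.1 hm.2 h3 h4 ▸ hk')
  · have h1 : (K * j + (K - 2)) / K = j := by
      rw [Nat.mul_add_div hK0, Nat.div_eq_of_lt (by omega), add_zero]
    have h2 : (K * j + (K - 2)) % K = K - 2 := by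
      rw [Nat.mul_add_mod, Nat.mod_eq_of_lt (by omega)]
    rw [runDigits_of_not_inRun hb θ ω (by rwa [h1]), h2, if_neg (by omega), if_pos (by omega)]
  · have h1 : (K * j + (K - 2) + 1) / K = j := by
      rw [add_assoc, Nat.mul_add_div hK0, Nat.div_eq_of_lt (by omega), add_zero]
    have h2 : (K * j + (K - 2) + 1) % K = K - 2 + 1 := by
      rw [add_assoc, Nat.mul_add_mod, Nat.mod_eq_of_lt (by omega)]
    rw [runDigits_of_not_inRun hb θ ω (by rwa [h1]), h2, if_neg (by omega), if_neg (by omega)]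

open Classical in
-- At the start of a run the earlier runs have removed at most the fraction `1/M` of the blocks. The
-- density is lowest at the end of a run, where it has been multiplied by at least `S k / T k ≥ u`.
theorem le_count_not_inRun (hS : IsRunSystem η u v lam K M S T) (hM : 3 ≤ M) (hu : 0 ≤ u)
    (huv : u ≤ v) (hu1 : u ≤ 1) {j : ℕ} (hj : ¬ InRun S T j) :
    (1 - 1 / (M : ℝ)) * u * j ≤ Nat.count (fun j => ¬ InRun S T j) j := by
  have hM0 : (0 : ℝ) < M := by exact_mod_cast (by omega : 0 < M)
  have hM1 : (1 : ℝ) ≤ M := by exact_mod_cast (by omega : 1 ≤ M)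
  have hc0 : 0 ≤ 1 - 1 / (M : ℝ) := by rw [sub_nonneg, div_le_one hM0]; exact hM1
  have hc1 : 1 - 1 / (M : ℝ) ≤ 1 := by
    have : 0 ≤ 1 / (M : ℝ) := by positivity
    linarith
  have hstart : ∀ k, (1 - 1 / (M : ℝ)) * S k ≤ Nat.count (fun j => ¬ InRun S T j) (S k) := by
    intro k
    cases k with
    | zero =>
      have h := le_count_of_forall (fun j => ¬ InRun S T j) (Nat.zero_le (S 0))
        fun i _ hi => hS.not_inRun_of_lt_start hM hi
      have h' : (S 0 : ℝ) ≤ Nat.count (fun j => ¬ InRun S T j) (S 0) := by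
        exact_mod_cast (by omega)
      exact (mul_le_of_le_one_left (by positivity) hc1).trans h'
    | succ k =>
      have h1 := hS.le_succ hM k
      have h := le_count_of_forall (fun j => ¬ InRun S T j) (show T k ≤ S (k + 1) by omega)
        fun i h1 h2 => hS.not_inRun_of_between hM h1 h2
      have h2 : (S (k + 1) : ℝ) ≤
          ((Nat.count (fun j => ¬ InRun S T j) (S (k + 1)) + T k : ℕ) : ℝ) := by
        exact_mod_cast (by omega)
      have h3 : (M : ℝ) * T k ≤ S (k + 1) := by exact_mod_cast hS.mul_le k
      have h4 : (T k : ℝ) ≤ 1 / (M : ℝ) * S (k + 1) := by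
        rw [one_div, ← div_eq_inv_mul, le_div_iff₀' hM0]; exact h3
      push_cast at h2
      linarith
  rcases hS.exists_between hM hj with hj0 | ⟨k, h1, h2⟩
  · have h := le_count_of_forall (fun j => ¬ InRun S T j) (Nat.zero_le j)
      fun i _ hi => hS.not_inRun_of_lt_start hM (hi.trans hj0)
    have h' : (j : ℝ) ≤ Nat.count (fun j => ¬ InRun S T j) j := by exact_mod_cast (by omega)
    exact (mul_le_of_le_one_left (by positivity) (mul_le_one₀ hc1 hu hu1)).trans h'
  · have h := le_count_of_forall (fun j => ¬ InRun S T j) h1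
      fun i h3 h4 => hS.not_inRun_of_between hM h3 (h4.trans h2)
    have h3 := Nat.count_monotone (fun j => ¬ InRun S T j) (hS.le k)
    have h4 : ((Nat.count (fun j => ¬ InRun S T j) (S k) : ℕ) : ℝ) + j ≤
        ((Nat.count (fun j => ¬ InRun S T j) j : ℕ) : ℝ) + T k := by
      exact_mod_cast (by omega)
    have h5 : u * T k ≤ S k := by
      by_cases hk : Even k
      · exact hS.even_le k hk
      · exact (mul_le_mul_of_nonneg_right huv (by positivity)).trans (hS.odd_le k hk)
    have h6 : (T k : ℝ) ≤ j := by exact_mod_cast h1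
    have h7 := mul_le_mul_of_nonneg_left h5 hc0
    have h8 : (1 - 1 / (M : ℝ)) * u * (j - T k) ≤ j - T k :=
      mul_le_of_le_one_left (by linarith) (mul_le_one₀ hc1 hu hu1)
    have h9 := hstart k
    linarith

open Classical in
theorem le_count_freeAt_mul (hK : 3 ≤ K) (S T : ℕ → ℕ) (j : ℕ) :
    (K - 2) * Nat.count (fun j => ¬ InRun S T j) j ≤ Nat.count (FreeAt K S T) (K * j) := by
  have hK0 : 0 < K := by omega
  induction j with
  | zero => simp
  | succ j ih =>
    have hmono : K * j + (K - 2) ≤ K * (j + 1) := by rw [Nat.mul_succ]; omega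
    have h1 := Nat.count_monotone (FreeAt K S T) hmono
    rw [Nat.count_succ]
    split_ifs with hj
    · have h2 := Nat.count_monotone (FreeAt K S T) (Nat.le_add_right (K * j) (K - 2))
      rw [add_zero]
      omega
    · have h2 := le_count_of_forall (FreeAt K S T) (Nat.le_add_right (K * j) (K - 2))
        fun i h3 h4 => by
          obtain ⟨c, rfl⟩ := Nat.exists_eq_add_of_le h3
          have e1 : (K * j + c) / K = j := by
            rw [Nat.mul_add_div hK0, Nat.div_eq_of_lt (by omega), add_zero]
          have e2 : (K * j + c) % K = c := by
            rw [Nat.mul_add_mod, Nat.mod_eq_of_lt (by omega)]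
          refine ⟨by rwa [e1], by omega⟩
      rw [Nat.mul_add, Nat.mul_one]
      omega

theorem infinite_freeAt (hS : IsRunSystem η u v lam K M S T) (hK : 3 ≤ K) (hM : 3 ≤ M) :
    {n | FreeAt K S T n}.Infinite := by
  have hK0 : 0 < K := by omega
  rw [Set.infinite_iff_exists_gt]
  intro N
  refine ⟨K * T N, ⟨?_, ?_⟩, ?_⟩
  · rw [Nat.mul_div_cancel_left _ hK0]; exact (hS.not_inRun_stop hM N).1
  · rw [Nat.mul_mod_right]; omega
  · have h1 := hS.lt_start hM N
    have h2 := hS.le N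
    have h3 := Nat.le_mul_of_pos_left (T N) hK0
    omega

open Classical in
-- If two free sequences first differ at index `j₀`, the points they define first differ at the
-- position `N` of that free digit. The values of the sequences are within `b^(-j₀)`, the points at
-- least `b^(-(N + 1 + K))` apart, and the density of free digits gives `r (N - K) ≤ j₀`.
theorem le_dimH_range_runDigits (hS : IsRunSystem η u v lam K M S T) (hK : 3 ≤ K) (hM : 3 ≤ M)
    (hb : 2 ≤ b) (hu : 0 ≤ u) (huv : u ≤ v) (hu1 : u ≤ 1) (θ : ℕ → Fin b) {r : ℝ} (hr : 0 < r)
    (hrK : r * K ≤ ((K : ℝ) - 2) * ((1 - 1 / (M : ℝ)) * u)) :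
    ENNReal.ofReal r ≤ dimH (range fun ω => Real.ofDigits (runDigits hb K S T θ ω)) := by
  have hb1 : (1 : ℝ) ≤ b := by exact_mod_cast (by omega : 1 ≤ b)
  have hb0 : (0 : ℝ) < b := by positivity
  have hK0 : 0 < K := by omega
  have hinf := infinite_freeAt hS hK hM
  refine le_dimH_range_of_holder (Z := fun ω : ℕ → Fin b => Real.ofDigits ω)
    (C := (b : ℝ) ^ (r * (1 + 2 * K))) (by positivity) hr (fun ω ω' => ?_) ?_
  · by_cases hω : ω = ω'
    · subst hω
      simp [Real.zero_rpow hr.ne']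
    have hex : ∃ i, ω i ≠ ω' i := Function.ne_iff.1 hω
    set j₀ := Nat.find hex with hj₀
    have hne : ω j₀ ≠ ω' j₀ := Nat.find_spec hex
    have heq : ∀ i < j₀, ω i = ω' i := fun i hi => not_not.1 (Nat.find_min hex hi)
    set N := Nat.nth (FreeAt K S T) j₀ with hN
    have hNfree : FreeAt K S T N := Nat.nth_mem_of_infinite hinf j₀
    have hcount : Nat.count (FreeAt K S T) N = j₀ := Nat.count_nth_of_infinite hinf j₀
    have hlow : ∀ i < N, runDigits hb K S T θ ω i = runDigits hb K S T θ ω' i := by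
      intro i hi
      by_cases hrun : InRun S T (i / K)
      · simp [runDigits, hrun]
      · rw [runDigits_of_not_inRun hb θ ω hrun, runDigits_of_not_inRun hb θ ω' hrun]
        split_ifs with h1
        · have hfree : FreeAt K S T i := ⟨hrun, h1⟩
          have hlt : Nat.count (FreeAt K S T) i < j₀ := hcount ▸ Nat.count_strict_mono hfree hi
          exact heq _ hlt
        all_goals rfl
    have hdiff : runDigits hb K S T θ ω N ≠ runDigits hb K S T θ ω' N := by
      rw [runDigits_of_not_inRun hb θ ω hNfree.1, runDigits_of_not_inRun hb θ ω' hNfree.1,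
        if_pos hNfree.2, if_pos hNfree.2, hcount]
      exact hne
    have hdiv := Nat.div_add_mod N K
    have hmod := hNfree.2
    have hzero : ∀ ω : ℕ → Fin b,
        ∃ i < K, (runDigits hb K S T θ ω (N + 1 + i) : ℕ) = 0 := fun ω => by
      -- This offset reaches the fixed digit 0 near the end of the block containing `N`, which rules
      -- out near-coincidences caused by carries.
      refine ⟨K - 3 - N % K, by omega, ?_⟩
      have e : N + 1 + (K - 3 - N % K) = K * (N / K) + (K - 2) := by omega
      rw [e]
      exact (isRunExpansion_runDigits hS hK hM hb θ ω).free_zero _ hNfree.1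
    have hX := le_abs_ofDigits_sub hb hlow hdiff (hzero ω) (hzero ω')
    have hZ := Real.abs_ofDigits_sub_ofDigits_le heq
    have hj : r * (N - K) ≤ j₀ := by
      have h1 := le_count_not_inRun hS hM hu huv hu1 hNfree.1
      have h2 := le_count_freeAt_mul hK S T (N / K)
      have h3 := Nat.count_monotone (FreeAt K S T) (show K * (N / K) ≤ N by omega)
      rw [hcount] at h3
      have h4 : ((K - 2 : ℕ) : ℝ) * (Nat.count (fun j => ¬ InRun S T j) (N / K) : ℕ) ≤ j₀ := by
        exact_mod_cast h2.trans h3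
      have h5 : ((K - 2 : ℕ) : ℝ) = (K : ℝ) - 2 := by
        rw [Nat.cast_sub (by omega)]; norm_num
      have hK2 : (0 : ℝ) ≤ (K : ℝ) - 2 := by rw [← h5]; positivity
      rw [h5] at h4
      have h6 : (N : ℝ) ≤ K * (N / K : ℕ) + K := by
        exact_mod_cast (by omega : N ≤ K * (N / K) + K)
      have h7 := mul_le_mul_of_nonneg_left h1 hK2
      have h8 : r * K * ((N / K : ℕ) : ℝ) ≤
          ((K : ℝ) - 2) * ((1 - 1 / (M : ℝ)) * u) * ((N / K : ℕ) : ℝ) :=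
        mul_le_mul_of_nonneg_right hrK (by positivity)
      have h9 : r * (N - K) ≤ r * (K * ((N / K : ℕ) : ℝ)) :=
        mul_le_mul_of_nonneg_left (by linarith) hr.le
      linarith
    calc |Real.ofDigits ω - Real.ofDigits ω'| ≤ ((b : ℝ) ^ j₀)⁻¹ := hZ
      _ = (b : ℝ) ^ (-(j₀ : ℝ)) := by rw [Real.rpow_neg hb0.le, Real.rpow_natCast]
      _ ≤ (b : ℝ) ^ (r * (1 + 2 * K) + (-((N + 1 + K : ℕ) : ℝ)) * r) := by
          apply Real.rpow_le_rpow_of_exponent_le hb1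
          push_cast
          linarith
      _ = (b : ℝ) ^ (r * (1 + 2 * K)) * (1 / (b : ℝ) ^ (N + 1 + K)) ^ r := by
          rw [Real.rpow_add hb0, Real.rpow_mul hb0.le (-((N + 1 + K : ℕ) : ℝ)) r, Real.rpow_neg hb0.le, Real.rpow_natCast,
            one_div]
      _ ≤ _ := by gcongr
  · intro z hz
    obtain ⟨ω, -, hω⟩ := Real.ofDigits_SurjOn (b := b) (by omega) hz
    exact ⟨ω, hω⟩

end

/-! ### The bivariate level sets -/

/-- The points with prescribed inverse approximation exponents of `x` and `x - y`. -/
def exponentSet (b : ℕ) (y u v : ℝ) : Set ℝ :=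
  {x | invExponent b x = u ∧ invExponent b (x - y) = v}

theorem dimH_exponentSet_le {b : ℕ} (hb : 2 ≤ b) (y : ℝ) {u v : ℝ} (hu : 0 ≤ u) (hv : 0 ≤ v) :
    dimH (exponentSet b y u v) ≤ ENNReal.ofReal (min u v) := by
  rw [ENNReal.ofReal_min]
  exact le_min ((dimH_mono fun x hx => hx.1.le).trans (dimH_invExponent_le hb hu))
    ((dimH_mono fun x hx => hx.2.le).trans (dimH_invExponent_sub_le hb y hv))

/-- The reflection `x ↦ y - x` exchanges `x` and `x - y` up to sign, and the exponent is even. -/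
theorem exponentSet_swap (b : ℕ) (y u v : ℝ) :
    exponentSet b y u v = IsometryEquiv.subLeft y ⁻¹' exponentSet b y v u := by
  ext x
  simp only [exponentSet, mem_preimage, mem_ofPred_eq, IsometryEquiv.subLeft_apply,
    sub_sub_cancel_left, invExponent_neg]
  rw [← invExponent_neg b (y - x), neg_sub, and_comm]

namespace IsLacunary

variable {b : ℕ} {η C : ℝ} {lam : ℕ → ℕ} {θ : ℕ → Fin b}

/-- Letting `K = M → ∞` brings the dimension bound arbitrarily close to `u`. Nonemptiness is
recorded separately because for `u = 0` the bound says nothing. -/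
theorem exponentSet_nonempty_and_le_dimH (h : IsLacunary η C lam θ) (hb : 2 ≤ b) {u v : ℝ}
    (hu : 0 ≤ u) (huv : u ≤ v) (hv1 : v ≤ 1) (hv : v ≤ η⁻¹ ∨ v ^ 2 ≤ u) :
    (exponentSet b (Real.ofDigits θ) u v).Nonempty ∧
      ENNReal.ofReal u ≤ dimH (exponentSet b (Real.ofDigits θ) u v) := by
  have hsys : ∀ K M : ℕ, 3 ≤ K → 3 ≤ M → ∃ S T, IsRunSystem η u v lam K M S T ∧
      (range fun ω => Real.ofDigits (runDigits hb K S T θ ω)) ⊆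
        exponentSet b (Real.ofDigits θ) u v := by
    intro K M hK hM
    obtain ⟨S, T, hS⟩ := exists_isRunSystem (η := η) hu (huv.trans hv1) (hu.trans huv) hv1
      h.strictMono (show 0 < K by omega) M
    refine ⟨S, T, hS, ?_⟩
    rintro _ ⟨ω, rfl⟩
    have hE := isRunExpansion_runDigits hS hK hM hb θ ω
    exact ⟨hE.invExponent_eq hS hK hM hb hu huv hv1,
      hE.invExponent_sub_eq h hS hK hM hb (hu.trans huv) hv1 hv⟩
  constructor
  · obtain ⟨S, T, -, hsub⟩ := hsys 3 3 le_rfl le_rfl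
    exact ⟨_, hsub ⟨θ, rfl⟩⟩
  · refine le_of_forall_lt fun c hc => ?_
    obtain ⟨d, hcd, hdu⟩ := ENNReal.lt_iff_exists_nnreal_btwn.1 hc
    have hdu' : (d : ℝ) < u := by
      rwa [← ENNReal.ofReal_coe_nnreal, ENNReal.ofReal_lt_ofReal_iff_of_nonneg d.coe_nonneg] at hdu
    have hd0 : 0 < (d : ℝ) := by
      have : (0 : ENNReal) < d := lt_of_le_of_lt zero_le hcd
      exact_mod_cast this
    have hlim : Tendsto (fun n : ℕ => (1 - 2 * (1 / ((n : ℝ) + 1))) *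
        ((1 - 1 / ((n : ℝ) + 1)) * u)) atTop (𝓝 ((1 - 2 * 0) * ((1 - 0) * u))) := by
      have h0 := tendsto_one_div_add_atTop_nhds_zero_nat (𝕜 := ℝ)
      exact (tendsto_const_nhds.sub (h0.const_mul 2)).mul
        ((tendsto_const_nhds.sub h0).mul_const u)
    have hev := hlim.eventually_const_lt (show (d : ℝ) < (1 - 2 * 0) * ((1 - 0) * u) by simpa)
    obtain ⟨n, hn, hn2⟩ := (hev.and (eventually_ge_atTop 2)).exists
    obtain ⟨S, T, hS, hsub⟩ := hsys (n + 1) (n + 1) (by omega) (by omega)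
    have hle := le_dimH_range_runDigits hS (by omega) (by omega) hb hu huv (huv.trans hv1) θ
      (r := d) hd0 (by
        push_cast
        have hn1 : (0 : ℝ) < (n : ℝ) + 1 := by positivity
        refine (mul_le_mul_of_nonneg_right hn.le hn1.le).trans (le_of_eq ?_)
        have : (n : ℝ) + 1 - 2 = (1 - 2 * (1 / ((n : ℝ) + 1))) * (n + 1) := by field_simp
        rw [this]; ring)
    rw [ENNReal.ofReal_coe_nnreal] at hle
    exact hcd.trans_le (hle.trans (dimH_mono hsub))

theorem hausdorffDim_exponentSet (h : IsLacunary η C lam θ) (hb : 2 ≤ b) {u v : ℝ}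
    (hu : 0 ≤ u) (hu1 : u ≤ 1) (hv : 0 ≤ v) (hv1 : v ≤ 1) (huv : u ≤ η⁻¹ ∨ u ^ 2 ≤ v)
    (hvu : v ≤ η⁻¹ ∨ v ^ 2 ≤ u) :
    hausdorffDim (exponentSet b (Real.ofDigits θ) u v) = ((min u v : ℝ) : EReal) := by
  have key : (exponentSet b (Real.ofDigits θ) u v).Nonempty ∧
      ENNReal.ofReal (min u v) ≤ dimH (exponentSet b (Real.ofDigits θ) u v) := by
    rcases le_total u v with hle | hle
    · rw [min_eq_left hle]
      exact h.exponentSet_nonempty_and_le_dimH hb hu hle hv1 hvu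
    · obtain ⟨⟨x, hx⟩, hd⟩ := h.exponentSet_nonempty_and_le_dimH hb hv hle hu1 huv
      rw [min_eq_right hle, exponentSet_swap, IsometryEquiv.dimH_preimage]
      refine ⟨⟨Real.ofDigits θ - x, ?_⟩, hd⟩
      simpa using hx
  rw [hausdorffDim, if_neg key.1.ne_empty,
    le_antisymm (dimH_exponentSet_le hb _ hu hv) key.2, EReal.coe_ennreal_ofReal,
    max_eq_left (le_min hu hv)]

theorem exponentSet_eq_empty (h : IsLacunary η C lam θ) (hb : 2 ≤ b) {u v : ℝ}
    (hn : ¬ (u ∈ Icc 0 1 ∧ v ∈ Icc 0 1 ∧ (u ≤ η⁻¹ ∨ u ^ 2 ≤ v) ∧ (v ≤ η⁻¹ ∨ v ^ 2 ≤ u))) :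
    exponentSet b (Real.ofDigits θ) u v = ∅ := by
  rw [Set.eq_empty_iff_forall_notMem]
  rintro x ⟨rfl, rfl⟩
  refine hn ⟨⟨invExponent_nonneg _ _, invExponent_le_one _ _⟩,
    ⟨invExponent_nonneg _ _, invExponent_le_one _ _⟩, ?_, ?_⟩
  · rcases le_max_iff.1 (h.invExponent_le hb x) with h1 | h1
    · exact Or.inr ((Real.le_sqrt (invExponent_nonneg _ _) (invExponent_nonneg _ _)).1 h1)
    · exact Or.inl h1
  · rcases le_max_iff.1 (h.invExponent_sub_le hb x) with h1 | h1
    · exact Or.inr ((Real.le_sqrt (invExponent_nonneg _ _) (invExponent_nonneg _ _)).1 h1)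
    · exact Or.inl h1

end IsLacunary

/-- Outside the small square the larger coordinate exceeds `η⁻¹` and its constraint is the quadratic
one. The constraint on the smaller coordinate then follows from `t² ≤ t` on `[0, 1]`. -/
theorem region_iff {η u v : ℝ} (hη : 1 < η) :
    (u ∈ Icc 0 1 ∧ v ∈ Icc 0 1 ∧ (u ≤ η⁻¹ ∨ u ^ 2 ≤ v) ∧ (v ≤ η⁻¹ ∨ v ^ 2 ≤ u)) ↔
      ((u ∈ Icc 0 η⁻¹ ∧ v ∈ Icc 0 η⁻¹) ∨ (v ∈ Icc η⁻¹ 1 ∧ u ∈ Icc (v ^ 2) v) ∨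
        (u ∈ Icc η⁻¹ 1 ∧ v ∈ Icc (u ^ 2) u)) := by
  have hη0 : 0 < η⁻¹ := inv_pos.2 (by linarith)
  have hη1 : η⁻¹ ≤ 1 := inv_le_one_of_one_le₀ hη.le
  constructor
  · rintro ⟨⟨hu0, hu1⟩, ⟨hv0, hv1⟩, h1, h2⟩
    by_cases hu : u ≤ η⁻¹
    · by_cases hv : v ≤ η⁻¹
      · exact Or.inl ⟨⟨hu0, hu⟩, hv0, hv⟩
      · push Not at hv
        exact Or.inr (Or.inl ⟨⟨hv.le, hv1⟩, h2.resolve_left (not_le.2 hv), hu.trans hv.le⟩)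
    · push Not at hu
      have h1 := h1.resolve_left (not_le.2 hu)
      rcases le_total v u with hvu | huv
      · exact Or.inr (Or.inr ⟨⟨hu.le, hu1⟩, h1, hvu⟩)
      · have hv := hu.trans_le huv
        exact Or.inr (Or.inl ⟨⟨hv.le, hv1⟩, h2.resolve_left (not_le.2 hv), huv⟩)
  · rintro (⟨⟨hu0, hu⟩, hv0, hv⟩ | ⟨⟨hv, hv1⟩, h1, h2⟩ | ⟨⟨hu, hu1⟩, h1, h2⟩)
    · exact ⟨⟨hu0, hu.trans hη1⟩, ⟨hv0, hv.trans hη1⟩, Or.inl hu, Or.inl hv⟩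
    · have hu0 : 0 ≤ u := (sq_nonneg v).trans h1
      exact ⟨⟨hu0, h2.trans hv1⟩, ⟨hη0.le.trans hv, hv1⟩, Or.inr (by nlinarith), Or.inr h1⟩
    · have hv0 : 0 ≤ v := (sq_nonneg u).trans h1
      exact ⟨⟨hη0.le.trans hu, hu1⟩, ⟨hv0, h2.trans hu1⟩, Or.inr h1, Or.inr (by nlinarith)⟩

theorem scaled_region_iff {α₁ α₂ η H₁ H₂ : ℝ} (hα₁ : 0 < α₁) (hα₂ : 0 < α₂) :
    ((H₁ ∈ Icc 0 (α₁ / η) ∧ H₂ ∈ Icc 0 (α₂ / η)) ∨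
      (H₂ ∈ Icc (α₂ / η) α₂ ∧ H₁ ∈ Icc (α₁ * H₂ ^ 2 / α₂ ^ 2) (α₁ * H₂ / α₂)) ∨
      (H₁ ∈ Icc (α₁ / η) α₁ ∧ H₂ ∈ Icc (α₂ * H₁ ^ 2 / α₁ ^ 2) (α₂ * H₁ / α₁))) ↔
    ((H₁ / α₁ ∈ Icc 0 η⁻¹ ∧ H₂ / α₂ ∈ Icc 0 η⁻¹) ∨
      (H₂ / α₂ ∈ Icc η⁻¹ 1 ∧ H₁ / α₁ ∈ Icc ((H₂ / α₂) ^ 2) (H₂ / α₂)) ∨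
      (H₁ / α₁ ∈ Icc η⁻¹ 1 ∧ H₂ / α₂ ∈ Icc ((H₁ / α₁) ^ 2) (H₁ / α₁))) := by
  obtain ⟨u, rfl⟩ : ∃ u, H₁ = α₁ * u := ⟨H₁ / α₁, by field_simp⟩
  obtain ⟨v, rfl⟩ : ∃ v, H₂ = α₂ * v := ⟨H₂ / α₂, by field_simp⟩
  have e1 : α₁ * (α₂ * v) ^ 2 / α₂ ^ 2 = α₁ * v ^ 2 := by field_simp
  have e2 : α₂ * (α₁ * u) ^ 2 / α₁ ^ 2 = α₂ * u ^ 2 := by field_simp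
  have e3 : α₁ * (α₂ * v) / α₂ = α₁ * v := by field_simp
  have e4 : α₂ * (α₁ * u) / α₁ = α₂ * u := by field_simp
  simp only [mem_Icc, e1, e2, e3, e4, mul_div_cancel_left₀ _ hα₁.ne', mul_div_cancel_left₀ _ hα₂.ne',
    div_eq_mul_inv _ η, mul_le_mul_iff_right₀ hα₁, mul_le_mul_iff_right₀ hα₂,
    mul_nonneg_iff_of_pos_left hα₁, mul_nonneg_iff_of_pos_left hα₂, mul_le_iff_le_one_right hα₁,
    mul_le_iff_le_one_right hα₂]

end LevySpectrum

end

end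

theorem proposition3
    (b : ℕ) (hb : 2 ≤ b) (α₁ α₂ : ℝ) (hα₁ : 0 < α₁) (hα₂ : 0 < α₂)
    (η : ℝ) (hη : 1 < η)
    (l : ℕ → ℕ) (hl_mono : StrictMono l)
    (hl : ∀ i, l (i + 1) = ⌊(l i : ℝ) * η⌋₊)
    (y : ℝ) (θ : ℕ → Fin b) (hy : y = Real.ofDigits θ)
    (hθ : LevySpectrum.IsConcatenation (fun i => LevySpectrum.block η (l i))
      (fun n => (θ n : ℕ))) :
    LevySpectrum.approxExponent b y = (η : EReal) ∧
    ∀ H₁ H₂ : ℝ,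
      ((H₁ ∈ Set.Icc 0 α₁ ∧ H₂ = α₂ / α₁ * H₁) →
        LevySpectrum.spectrum (LevySpectrum.levy b α₁) (LevySpectrum.levyTranslate b α₂ y) H₁ H₂
          = ((H₁ / α₁ : ℝ) : EReal)) ∧
      (((H₁ ∈ Set.Icc 0 (α₁ / η) ∧ H₂ ∈ Set.Icc 0 (α₂ / η)) ∨
          (H₂ ∈ Set.Icc (α₂ / η) α₂ ∧
            H₁ ∈ Set.Icc (α₁ * H₂ ^ 2 / α₂ ^ 2) (α₁ * H₂ / α₂)) ∨
          (H₁ ∈ Set.Icc (α₁ / η) α₁ ∧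
            H₂ ∈ Set.Icc (α₂ * H₁ ^ 2 / α₁ ^ 2) (α₂ * H₁ / α₁))) →
        LevySpectrum.spectrum (LevySpectrum.levy b α₁) (LevySpectrum.levyTranslate b α₂ y) H₁ H₂
          = ((min (H₁ / α₁) (H₂ / α₂) : ℝ) : EReal)) ∧
      (¬ (H₁ ∈ Set.Icc 0 α₁ ∧ H₂ = α₂ / α₁ * H₁) →
        ¬ ((H₁ ∈ Set.Icc 0 (α₁ / η) ∧ H₂ ∈ Set.Icc 0 (α₂ / η)) ∨
          (H₂ ∈ Set.Icc (α₂ / η) α₂ ∧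
            H₁ ∈ Set.Icc (α₁ * H₂ ^ 2 / α₂ ^ 2) (α₁ * H₂ / α₂)) ∨
          (H₁ ∈ Set.Icc (α₁ / η) α₁ ∧
            H₂ ∈ Set.Icc (α₂ * H₁ ^ 2 / α₁ ^ 2) (α₂ * H₁ / α₁))) →
        LevySpectrum.spectrum (LevySpectrum.levy b α₁) (LevySpectrum.levyTranslate b α₂ y) H₁ H₂
          = ⊥) := by
  subst hy
  have hlac := LevySpectrum.isLacunary_of_isConcatenation hη hl_mono hl hθ
  refine ⟨hlac.approxExponent_eq hb, fun H₁ H₂ => ?_⟩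
  rw [LevySpectrum.scaled_region_iff hα₁ hα₂, ← LevySpectrum.region_iff hη,
    LevySpectrum.spectrum, LevySpectrum.levelSet_levy hb hα₁ hα₂]
  have hdim := fun hR : H₁ / α₁ ∈ Set.Icc 0 1 ∧ H₂ / α₂ ∈ Set.Icc 0 1 ∧
      (H₁ / α₁ ≤ η⁻¹ ∨ (H₁ / α₁) ^ 2 ≤ H₂ / α₂) ∧ (H₂ / α₂ ≤ η⁻¹ ∨ (H₂ / α₂) ^ 2 ≤ H₁ / α₁) =>
    hlac.hausdorffDim_exponentSet hb hR.1.1 hR.1.2 hR.2.1.1 hR.2.1.2 hR.2.2.1 hR.2.2.2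
  refine ⟨?_, fun hR => hdim hR, fun _ hR => ?_⟩
  · rintro ⟨⟨h0, h1⟩, rfl⟩
    have e : α₂ / α₁ * H₁ / α₂ = H₁ / α₁ := by field_simp
    rw [e] at hdim ⊢
    have hu0 : 0 ≤ H₁ / α₁ := by positivity
    have hu1 : H₁ / α₁ ≤ 1 := (div_le_one hα₁).2 h1
    -- The diagonal lies in the admissible region, so the first case is an instance of the general
    -- formula.
    have hsq : (H₁ / α₁) ^ 2 ≤ H₁ / α₁ := by nlinarith
    have := hdim ⟨⟨hu0, hu1⟩, ⟨hu0, hu1⟩, Or.inr hsq, Or.inr hsq⟩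
    rwa [min_self] at this
  · have h := hlac.exponentSet_eq_empty hb hR
    rw [LevySpectrum.exponentSet] at h
    rw [h, LevySpectrum.hausdorffDim, if_pos rfl]
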